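/- **Setting.** A grid diagram $\mathbb G$ with grid number $n$ is an $n\times n$ grid of squares, columns numbered from west to east and rows from south to north, with markings $X$ and $O$ such that every row and every column contains exactly one $X$ and one $O$, and no square contains both. It determines an oriented link, which runs in each column from $X$ to $O$ and in each row from $O$ to $X$, vertical segments passing over horizontal ones. We regard the grid as a torus by identifying opposite sides. A grid state $\mathbf x$ is a set of $n$ points of the torus, one on each of the $n$ horizontal and on each of the $n$ vertical circles of the grid; $\mathbf S(\mathbb G)$ is the set of grid states. $\mathrm{Rect}^\circ(\mathbf x,\mathbf y)$ is the set of embedded rectangles $r$ from $\mathbf x$ to $\mathbf y$ (the states agree off the four corners of $r$; the south-west and north-east corners of $r$ belong to $\mathbf x$, the other two to $\mathbf y$) with no point of $\mathbf x$ or $\mathbf y$ in the interior. For finite sets $P,Q$ in the plane let $\mathcal I(P,Q)$ be the number of pairs $(p,q)\in P\times Q$ with $q$ strictly north-east of $p$, and $\mathcal J(P,Q)=\frac12(\mathcal I(P,Q)+\mathcal I(Q,P))$. With all points placed in the square $[0,n)\times[0,n)$ and markings at the centres of their squares, put $M_{\mathbb P}(\mathbf x)=\mathcal J(\mathbf x,\mathbf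 x)-2\mathcal J(\mathbf x,\mathbb P)+\mathcal J(\mathbb P,\mathbb P)+1$ for $\mathbb P=\mathbb O,\mathbb X$, $M=M_{\mathbb O}$ and $A=\frac12(M_{\mathbb O}-M_{\mathbb X})-\frac{n-1}2$. For $t\in[0,2]$ let $\mathcal R_t$ be the subring generated by $U^t$ and $U^{2-t}$ in the ring of long power series $\sum_{\alpha\in S}U^\alpha$ over $\mathbb F_2$ ($S\subset\mathbb R_{\ge0}$ well-ordered). Let $tGC^-(\mathbb G)$ be the free $\mathcal R_t$-module on $\mathbf S(\mathbb G)$ with the $\mathcal R_t$-linear differential $$\partial^-_t\mathbf x=\sum_{\mathbf y\in\mathbf S(\mathbb G)}\ \sum_{r\in\mathrm{Rect}^\circ(\mathbf x,\mathbf y)}U^{t|\mathbb X\cap r|+(2-t)|\mathbb O\cap r|}\,\mathbf y ,$$ let $tGC^-_d(\mathbb G)$ be the $\mathbb F_2$-span of the monomials $U^\alpha\mathbf x$ with $M(\mathbf x)-tA(\mathbf x)-\alpha=d$, and let $tGH^-(\mathbb G)=\operatorname{Ker}\partial_t^- /\operatorname{Im}\partial_t^-$, an $\mathcal R_t$-module,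 graded by the subspaces $tGH^-_d(\mathbb G)$ of classes of cycles in $tGC^-_d(\mathbb G)$, $d\in\mathbb R$. Two grid diagrams are related by a cross-commutation of columns if they differ by interchanging two consecutive columns (on the torus) for which the closed intervals joining the heights of their two markings have intersecting interiors, neither interval being contained in the other. Such an interchange changes one crossing of the link. We say that it leads from $\mathbb G_+$ to $\mathbb G_-$ if the crossing is positive for $\mathbb G_+$ and negative for $\mathbb G_-$; explicitly, if in $\mathbb G_+$ the markings of the two columns occur, going north around the torus, in the cyclic order $X_E,X_W,O_E,O_W$, where $W$ is the western and $E$ the eastern column. A cross-commutation of rows from $\mathbb G_+$ to $\mathbb G_-$ is obtained from this by reflecting both diagrams in the diagonal. **Proposition.** Let $\mathbb G_+$ and $\mathbb G_-$ be grid diagrams of knots $K_+$ and $K_-$ that are related by a cross-commutation (of columns or of rows) which changes a positive crossing of $K_+$ into a negative crossing of $K_-$, and let $t\in[0,2]$. Then there are $\mathcal R_t$-module maps $$C_-\colon tGH^-(\mathbb G_+)\to tGH^-(\mathbb G_-),\qquad C_+\colon tGH^-(\mathbb G_-)\to tGH^-(\mathbb G_+)$$ such that $C_-$ is homogeneous of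 degree $0$ (it preserves the grading), $C_+$ is homogeneous of degree $-2+t$, and both composites $C_-\circ C_+$ and $C_+\circ C_-$ are multiplication by $U^{2-t}$. -/

import Mathlib

open scoped NNReal

noncomputable section

/-! ### Grid diagrams -/

/-- A planar grid diagram with grid number `n`. Columns are numbered from west to east and rows from
south to north; `X c` and `O c` are the rows of the `X`- and of the `O`-marking of column `c`. That
`X` and `O` are permutations says that every row and every column contains exactly one marking of
each kind. The same data is a toroidal grid diagram together with a planar realization of it. -/
structure GridDiagram (n : ℕ) where
  X : Equiv.Perm (Fin n)
  O : Equiv.Perm (Fin n)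
  X_ne_O : ∀ c, X c ≠ O c

namespace GridDiagram

variable {n : ℕ}

/-- The oriented link of a grid diagram runs in each column from the `X`-marking to the
`O`-marking and in each row from the `O`-marking to the `X`-marking (vertical segments pass over
horizontal ones). So from column `c` it proceeds to column `X⁻¹ (O c)`, and the link is a knot when
this permutation of the columns is one single cycle (it has no fixed points, as `X c ≠ O c`). -/
def IsKnot (G : GridDiagram n) : Prop := (G.X⁻¹ * G.O).IsCycle

/-- Reflection of a diagram in the diagonal, exchanging the roles of rows and columns. -/
def transpose (G : GridDiagram n) : GridDiagram n where
  X := G.X⁻¹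
  O := G.O⁻¹
  X_ne_O r h := G.X_ne_O (G.X⁻¹ r) (by
    have h1 : G.X (G.X⁻¹ r) = r := G.X.apply_symm_apply r
    have h2 : G.O (G.O⁻¹ r) = r := G.O.apply_symm_apply r
    rw [h1, h, h2])

/-- The closed interval of real numbers joining the heights of the two markings of column `c`. -/
def columnInterval (G : GridDiagram n) (c : Fin n) : Set ℝ :=
  Set.Icc (min ((G.O c : ℕ) : ℝ) ((G.X c : ℕ) : ℝ)) (max ((G.O c : ℕ) : ℝ) ((G.X c : ℕ) : ℝ))

/-- The intervals of the columns `i` and `j` have intersecting interiors, but neither of them is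
contained in the other. -/
def ColumnsCross (G : GridDiagram n) (i j : Fin n) : Prop :=
  ¬ Disjoint (interior (G.columnInterval i)) (interior (G.columnInterval j)) ∧
    ¬ G.columnInterval i ⊆ G.columnInterval j ∧ ¬ G.columnInterval j ⊆ G.columnInterval i

/-- `a`, `b`, `c`, `d` are four different elements which occur in this cyclic order. -/
def CyclicallyOrdered (a b c d : Fin n) : Prop :=
  (a < b ∧ b < c ∧ c < d) ∨ (b < c ∧ c < d ∧ d < a) ∨
    (c < d ∧ d < a ∧ a < b) ∨ (d < a ∧ a < b ∧ b < c)

/-- For consecutive columns `i` (west) and `j` (east) whose intervals cross, the four markings lie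
in different rows, and going north around the torus they occur in one of the two cyclic orders
`X j, X i, O j, O i` and `X i, X j, O i, O j`. Interchanging the columns exchanges the two orders.
In the first case the crossing which is changed by the interchange is positive before and negative
after it. (For instance, if the heights of `X j, X i, O j, O i` increase, the western strand lies
above the eastern one; each of the segments that leave `O j` or arrive at `X i` either gives a
positive crossing before the interchange or a negative one after it, according to whether it lies
to the west or to the east of `O j`, resp. to the east or to the west of `X i`. So the interchange
lowers the writhe by two.) -/
def PositiveColumns (G : GridDiagram n) (i j : Fin n) : Prop :=
  CyclicallyOrdered (G.X j) (G.X i) (G.O j) (G.O i)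

/-- `Gm` arises from `Gp` by a cross-commutation of two consecutive columns `i`, `j` of the
torus (column `n - 1` is followed by column `0`) which changes a positive crossing of `Gp` into a
negative crossing of `Gm`. -/
def ColumnCrossCommutation (Gp Gm : GridDiagram n) : Prop :=
  ∃ i j : Fin n, (j : ℕ) = ((i : ℕ) + 1) % n ∧
    Gp.ColumnsCross i j ∧ Gp.PositiveColumns i j ∧
    Gm.X = Gp.X * Equiv.swap i j ∧ Gm.O = Gp.O * Equiv.swap i j

/-- `Gm` arises from `Gp` by a cross-commutation (of columns or of rows) which changes a positive
crossing of `Gp` into a negative crossing of `Gm`. Reflecting the diagrams in the diagonal turns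
rows into columns. It preserves the signs of the crossings: reflecting the plane and then letting
the vertical segments pass over again is a rotation of space, followed by a reversal of
the orientation of the whole link. -/
def CrossCommutation (Gp Gm : GridDiagram n) : Prop :=
  ColumnCrossCommutation Gp Gm ∨ ColumnCrossCommutation Gp.transpose Gm.transpose

end GridDiagram

/-! ### Grid states and gradings -/

/-- A grid state: on the vertical circle `i` (the western boundary of column `i`) it has its point on
the horizontal circle `x i` (the southern boundary of row `x i`). -/
abbrev GridState (n : ℕ) := Equiv.Perm (Fin n)

/-- The number of pairs `(p, q)` with `p ∈ P`, `q ∈ Q` and `q` strictly to the north-east of `p`. -/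
def countNE (P Q : Finset (ℕ × ℕ)) : ℕ :=
  ((P ×ˢ Q).filter fun pq => pq.1.1 < pq.2.1 ∧ pq.1.2 < pq.2.2).card

/-- The symmetrized count `𝒥(P, Q) = (ℐ(P, Q) + ℐ(Q, P)) / 2`. -/
def countSymm (P Q : Finset (ℕ × ℕ)) : ℝ := ((countNE P Q : ℝ) + (countNE Q P : ℝ)) / 2

/-- The points of a grid state in the plane, with all coordinates doubled. -/
def statePoints {n : ℕ} (x : GridState n) : Finset (ℕ × ℕ) :=
  Finset.univ.image fun i : Fin n => (2 * (i : ℕ), 2 * (x i : ℕ))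

/-- The centres of the squares `(c, P c)` in the plane, with all coordinates doubled. -/
def markingPoints {n : ℕ} (P : Equiv.Perm (Fin n)) : Finset (ℕ × ℕ) :=
  Finset.univ.image fun c : Fin n => (2 * (c : ℕ) + 1, 2 * (P c : ℕ) + 1)

/-- The Maslov function with respect to the markings `P`,
`𝒥(x, x) - 2 𝒥(x, P) + 𝒥(P, P) + 1`. -/
def maslovWith {n : ℕ} (P : Equiv.Perm (Fin n)) (x : GridState n) : ℝ :=
  countSymm (statePoints x) (statePoints x) - 2 * countSymm (statePoints x) (markingPoints P)
    + countSymm (markingPoints P) (markingPoints P) + 1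

namespace GridDiagram

variable {n : ℕ}

/-- The Maslov grading `M = M_𝕆`. -/
def maslov (G : GridDiagram n) (x : GridState n) : ℝ := maslovWith G.O x

/-- The Alexander grading `A = (M_𝕆 - M_𝕏) / 2 - (n - 1) / 2`. -/
def alexander (G : GridDiagram n) (x : GridState n) : ℝ :=
  (maslovWith G.O x - maslovWith G.X x) / 2 - ((n : ℝ) - 1) / 2

end GridDiagram

/-! ### Rectangles on the torus -/

/-- The elements `i, i + 1, …, j - 1` of `ℤ/n`. -/
def cyclicIco {n : ℕ} (i j : Fin n) : Finset (Fin n) :=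
  Finset.univ.filter fun k => ((k - i : Fin n) : ℕ) < ((j - i : Fin n) : ℕ)

/-- An embedded rectangle in the torus whose sides lie on the vertical circles `west`, `east` and
on the horizontal circles `south`, `north`: it extends eastward from `west` to `east` and northward
from `south` to `north`, if necessary through the line along which the torus is cut. -/
structure GridRectangle (n : ℕ) where
  west : Fin n
  east : Fin n
  south : Fin n
  north : Fin n
  west_ne_east : west ≠ east
  south_ne_north : south ≠ north

namespace GridRectangle

variable {n : ℕ}

theorem corners_injective : Function.Injective
    (fun r : GridRectangle n => (r.west, r.east, r.south, r.north)) := by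
  rintro ⟨a, b, c, d, _, _⟩ ⟨a', b', c', d', _, _⟩ h
  simp only [Prod.mk.injEq] at h
  obtain ⟨rfl, rfl, rfl, rfl⟩ := h
  rfl

instance : Fintype (GridRectangle n) := Fintype.ofInjective _ corners_injective

/-- The squares (column, row) of the grid that make up the rectangle. -/
def squares (r : GridRectangle n) : Finset (Fin n × Fin n) :=
  cyclicIco r.west r.east ×ˢ cyclicIco r.south r.north

/-- The point on the vertical circle `p.1` and on the horizontal circle `p.2` is in the interior. -/
def InInterior (r : GridRectangle n) (p : Fin n × Fin n) : Prop :=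
  (p.1 ∈ cyclicIco r.west r.east ∧ p.1 ≠ r.west) ∧
    (p.2 ∈ cyclicIco r.south r.north ∧ p.2 ≠ r.south)

/-- The rectangle goes from `x` to `y`: the states agree away from its two vertical sides, and its
horizontal sides, oriented as part of the boundary (the southern side eastward, the northern side
westward), point from `x` to `y`. -/
def GoesFrom (r : GridRectangle n) (x y : GridState n) : Prop :=
  (∀ k, k ≠ r.west → k ≠ r.east → x k = y k) ∧
    x r.west = r.south ∧ y r.east = r.south ∧ x r.east = r.north ∧ y r.west = r.north

/-- No point of `x` or of `y` is in the interior of the rectangle. -/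
def IsEmptyFor (r : GridRectangle n) (x y : GridState n) : Prop :=
  ∀ k, ¬ r.InInterior (k, x k) ∧ ¬ r.InInterior (k, y k)

/-- The number of markings in the rectangle, where `P` is the set of squares `(c, P c)`. -/
def markingCount (r : GridRectangle n) (P : Equiv.Perm (Fin n)) : ℕ :=
  (Finset.univ.filter fun c => (c, P c) ∈ r.squares).card

end GridRectangle

open Classical in
/-- The set of empty rectangles from `x` to `y`. -/
def emptyRectangles {n : ℕ} (x y : GridState n) : Finset (GridRectangle n) :=
  Finset.univ.filter fun r => r.GoesFrom x y ∧ r.IsEmptyFor x y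

/-! ### The base ring -/

/-- The ring of long power series over `𝔽₂`: formal sums of powers `U ^ α` over a well-ordered set
of exponents `α ≥ 0`. -/
abbrev LongPowerSeries := HahnSeries ℝ≥0 (ZMod 2)

/-- The power `U ^ α`. -/
def Upow (α : ℝ≥0) : LongPowerSeries := HahnSeries.single α 1

/-- The subring of the long power series generated by `U ^ t` and `U ^ (2 - t)`, for `0 ≤ t ≤ 2`
(a subring is the same as an `𝔽₂`-subalgebra). -/
def tSubring (t : ℝ≥0) : Subalgebra (ZMod 2) LongPowerSeries :=
  Algebra.adjoin (ZMod 2) {Upow t, Upow (2 - t)}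

/-- The ring `ℛ_t`. -/
def TRing (t : ℝ≥0) : Type := tSubring t

instance (t : ℝ≥0) : CommRing (TRing t) := inferInstanceAs (CommRing (tSubring t))

instance (t : ℝ≥0) : Algebra (ZMod 2) (TRing t) := inferInstanceAs (Algebra (ZMod 2) (tSubring t))

theorem Upow_mul (α β : ℝ≥0) : Upow α * Upow β = Upow (α + β) := by
  simp [Upow, HahnSeries.single_mul_single]

theorem Upow_pow (α : ℝ≥0) (k : ℕ) : Upow α ^ k = Upow (α * k) := by
  simp [Upow, HahnSeries.single_pow, mul_comm]

theorem Upow_mem_tSubring (t : ℝ≥0) (a b : ℕ) : Upow (t * a + (2 - t) * b) ∈ tSubring t := by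
  rw [← Upow_mul, ← Upow_pow, ← Upow_pow]
  exact mul_mem (pow_mem (Algebra.subset_adjoin (by simp)) _)
    (pow_mem (Algebra.subset_adjoin (by simp)) _)

/-- The element `U ^ (t a + (2 - t) b)` of `ℛ_t`. -/
def tMonomial (t : ℝ≥0) (a b : ℕ) : TRing t := ⟨Upow (t * a + (2 - t) * b), Upow_mem_tSubring t a b⟩

/-- The element `U ^ (2 - t)` of `ℛ_t`. -/
def UtwoSub (t : ℝ≥0) : TRing t := ⟨Upow (2 - t), Algebra.subset_adjoin (by simp)⟩

/-! ### The `t`-modified grid complex and its homology -/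

namespace GridDiagram

variable {n : ℕ}

/-- The free `ℛ_t`-module generated by the (finitely many) grid states of `G`; an element is given
by its coefficients, and the generator `x` is `Pi.single x 1`. -/
abbrev tGC (_G : GridDiagram n) (t : ℝ≥0) := GridState n → TRing t

/-- The differential: the `ℛ_t`-linear map with
`∂ x = ∑ y, (∑ r, U ^ (t |𝕏 ∩ r| + (2 - t) |𝕆 ∩ r|)) y`, over the empty rectangles `r` from `x` to
`y`. -/
def tDiff (G : GridDiagram n) (t : ℝ≥0) : G.tGC t →ₗ[TRing t] G.tGC t :=
  Fintype.linearCombination (TRing t) fun x : GridState n =>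
    ∑ y : GridState n, Pi.single y
      (∑ r ∈ emptyRectangles x y, tMonomial t (r.markingCount G.X) (r.markingCount G.O))

/-- The `𝔽₂`-vector space generated by the monomials `U ^ α · x` of `t`-grading
`M(x) - t A(x) - α = d`. -/
def tGCHomogeneous (G : GridDiagram n) (t : ℝ≥0) (d : ℝ) : Submodule (ZMod 2) (G.tGC t) :=
  Submodule.span (ZMod 2) {z | ∃ (x : GridState n) (α : ℝ≥0) (hα : Upow α ∈ tSubring t),
    G.maslov x - (t : ℝ) * G.alexander x - (α : ℝ) = d ∧
      z = Pi.single x (⟨Upow α, hα⟩ : TRing t)}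

/-- The homology `Ker ∂ / Im ∂`, an `ℛ_t`-module. -/
abbrev tGH (G : GridDiagram n) (t : ℝ≥0) :=
  LinearMap.ker (G.tDiff t) ⧸
    (LinearMap.range (G.tDiff t)).submoduleOf (LinearMap.ker (G.tDiff t))

/-- The part of degree `d` of the homology: the classes of the cycles that are homogeneous of
`t`-grading `d`, that is, `(Ker ∂ ∩ tGC_d) / (Im ∂ ∩ tGC_d)`. -/
def tGHHomogeneous (G : GridDiagram n) (t : ℝ≥0) (d : ℝ) : Submodule (ZMod 2) (G.tGH t) :=
  ((G.tGCHomogeneous t d).comap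
      ((LinearMap.ker (G.tDiff t)).subtype.restrictScalars (ZMod 2))).map
    (((LinearMap.range (G.tDiff t)).submoduleOf
      (LinearMap.ker (G.tDiff t))).mkQ.restrictScalars (ZMod 2))

/-- A module map between homologies is homogeneous of degree `s` if it maps the part of each
degree `d` into the part of degree `d + s`. -/
def IsHomogeneousOfDegree {G G' : GridDiagram n} {t : ℝ≥0} (f : G.tGH t →ₗ[TRing t] G'.tGH t)
    (s : ℝ) : Prop :=
  ∀ d : ℝ, ∀ ξ ∈ G.tGHHomogeneous t d, f ξ ∈ G'.tGHHomogeneous t (d + s)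

end GridDiagram

end

/-!
A rectangle that starts at a grid state `x` is determined by its western and eastern side, a pair
of columns `(a, b)`: it is `[a, b] × [x a, x b]`, and it leads to the state `x * swap a b`. So the
grid states of all diagrams of grid number `n`, and the rectangles between them, are the same, and a
diagram enters only through the weights of the squares. The differential of the grid complex is the
matrix of the sums of the weights of empty rectangles (`tDiff_eq`).

The usual argument for `∂ ∘ ∂ = 0`, that the composites of two rectangles cancel in pairs except
for thin annuli, uses only that the weight of a rectangle is multiplicative under subdivision. It
remains valid for weights in a noncommutative ring, as long as the noncommuting factors are
attached to the rows along one single vertical circle and are multiplied in the order in which the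
point of the state on this circle passes the rows (`IsRectWeight`, `rectMatrix_sq_eq`). If the
thin annuli have the same weight, all that is left of the square are the two annuli on both
sides of the special circle (`HolonomyData.rectMatrix_sq`).

For a cross-commutation of the columns `i` and `j`, the special circle is the one between them. In
the torus with all other circles fixed, it can be drawn in two positions, one for each of the
diagrams, that meet twice, namely at the two ends of the row `ρ` of the `X`-marking of column `j`.
Instead of counting pentagons and hexagons one lets the weights take values in an algebra of
triangular matrices whose rows and columns stand alternately for the two positions (`zigzag`,
`crossingData`); an entry off the diagonal counts the rectangles which pass from one position to
the other at the ends of the row `ρ`. The diagonal entries of the matrix of rectangles are the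
differentials of the two diagrams, its entries next to the diagonal are the two maps, and the
entries below these are homotopies. The relations between them are the entries of its square. The
contribution of the two annuli to the composites of the maps is the weight of the column `j`
without the row `ρ`; what remains there is the `O`-marking, of weight `U ^ (2 - t)`
(`crossingMatrix_relations`, `prod_gridWeight_erase`).

The gradings change along an empty rectangle by the exponent of its weight minus one
(`sum_gridExponent`). The gradings of a state in the two diagrams differ by a function of the height
of its point on the special circle (`tGrading_swap`), whose increments are the differences of the
exponents of the squares on both sides. Hence the holonomy along the circle is homogeneous
(`isHom_upProd`, `isHom_downProd`), and its value at the row `ρ` gives the degrees of the two maps.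

The case of rows follows by reflection in the diagonal (`CrossingMaps.ofTranspose`).
-/

open scoped NNReal

namespace GridCrossing

section EmptyRectangles

/-! ### Cyclic order and empty rectangles -/

variable {n : ℕ}

/-- Going eastward (northward) around the circle from `a`, one meets `b` strictly before `c`. -/
def Cyc (a b c : Fin n) : Prop := (a < b ∧ b < c) ∨ (b < c ∧ c < a) ∨ (c < a ∧ a < b)

theorem Cyc.rotate {a b c : Fin n} (h : Cyc a b c) : Cyc b c a := by
  unfold Cyc at *; omega

theorem Cyc.ne {a b c : Fin n} (h : Cyc a b c) : a ≠ b ∧ b ≠ c ∧ a ≠ c := by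
  unfold Cyc at *; omega

theorem Cyc.not_swap {a b c : Fin n} (h : Cyc a b c) : ¬ Cyc a c b := by
  unfold Cyc at *; omega

theorem cyc_or_cyc {a b c : Fin n} (hab : a ≠ b) (hbc : b ≠ c) (hac : a ≠ c) :
    Cyc a b c ∨ Cyc a c b := by
  unfold Cyc at *; omega

theorem not_cyc_left (a b : Fin n) : ¬ Cyc a a b := by unfold Cyc; omega
theorem not_cyc_right (a b : Fin n) : ¬ Cyc a b b := by unfold Cyc; omega
theorem not_cyc_ends (a b : Fin n) : ¬ Cyc a b a := by unfold Cyc; omega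

theorem Cyc.trans_left {a b c k : Fin n} (h : Cyc a b c) (hk : Cyc a k b) : Cyc a k c := by
  unfold Cyc at *
  rcases h with h | h | h <;> rcases hk with hk | hk | hk <;> omega

theorem Cyc.trans_right {a b c k : Fin n} (h : Cyc a b c) (hk : Cyc a k b) : Cyc k b c := by
  unfold Cyc at *
  rcases h with h | h | h <;> rcases hk with hk | hk | hk <;> omega

theorem Cyc.arcs_of_mem {a b c k : Fin n} (h : Cyc a b c) (hk : Cyc a k b) :
    ¬ Cyc b k c ∧ ¬ Cyc c k a ∧ Cyc a k c ∧ ¬ Cyc b k a ∧ Cyc c k b :=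
  ⟨(h.trans_right hk).rotate.not_swap,
    (h.trans_left hk).rotate.rotate.not_swap, h.trans_left hk, hk.rotate.rotate.not_swap,
    (h.trans_right hk).rotate.rotate⟩

/-- A point different from `a`, `b`, `c` lies on one of the three arcs into which they cut the
circle, and this decides about the six arcs between two of them. -/
theorem Cyc.arcs {a b c k : Fin n} (h : Cyc a b c) (ha : k ≠ a) (hb : k ≠ b) (hc : k ≠ c) :
    (Cyc a k b ∧ ¬ Cyc b k c ∧ ¬ Cyc c k a ∧ Cyc a k c ∧ ¬ Cyc b k a ∧ Cyc c k b) ∨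
    (¬ Cyc a k b ∧ Cyc b k c ∧ ¬ Cyc c k a ∧ Cyc a k c ∧ Cyc b k a ∧ ¬ Cyc c k b) ∨
    (¬ Cyc a k b ∧ ¬ Cyc b k c ∧ Cyc c k a ∧ ¬ Cyc a k c ∧ Cyc b k a ∧ Cyc c k b) := by
  have h3 : Cyc a k b ∨ Cyc b k c ∨ Cyc c k a := by
    rcases cyc_or_cyc ha.symm hb h.ne.1 with h1 | h1
    · exact Or.inl h1
    rcases cyc_or_cyc hb.symm hc h.ne.2.1 with h2 | h2
    · exact Or.inr (Or.inl h2)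
    exact Or.inr (Or.inr (h1.rotate.trans_right h2))
  rcases h3 with h1 | h1 | h1
  · exact Or.inl ⟨h1, h.arcs_of_mem h1⟩
  · obtain ⟨g1, g2, g3, g4, g5⟩ := h.rotate.arcs_of_mem h1
    exact Or.inr (Or.inl ⟨g2, h1, g1, g5, g3, g4⟩)
  · obtain ⟨g1, g2, g3, g4, g5⟩ := h.rotate.rotate.arcs_of_mem h1
    exact Or.inr (Or.inr ⟨g1, g2, h1, g4, g5, g3⟩)

theorem Cyc.outside {a b c k : Fin n} (h : Cyc a b c) (hk : ¬ Cyc a k c) (ha : k ≠ a)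
    (hc : k ≠ c) : Cyc b c k ∧ Cyc a b k := by
  have h1 := (cyc_or_cyc ha.symm hc h.ne.2.2).resolve_left hk
  exact ⟨h1.trans_right h, h1.trans_left h⟩

theorem val_sub_eq (u v : Fin n) :
    ((u - v : Fin n) : ℕ) = if v ≤ u then (u : ℕ) - v else u + n - v := by
  rw [Fin.sub_def]
  have hu := u.2
  have hv := v.2
  split_ifs with h
  · rw [Fin.le_def] at h
    show (n - (v : ℕ) + u) % n = _
    rw [show n - (v : ℕ) + u = (u - v : ℕ) + n by omega, Nat.add_mod_right, Nat.mod_eq_of_lt]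
    omega
  · rw [Fin.le_def] at h
    show (n - (v : ℕ) + u) % n = _
    rw [Nat.mod_eq_of_lt] <;> omega

theorem mem_cyclicIco_iff {i j k : Fin n} :
    k ∈ cyclicIco i j ↔ (i ≤ k ∧ k < j) ∨ (j < i ∧ i ≤ k) ∨ (j < i ∧ k < j) := by
  simp only [cyclicIco, Finset.mem_filter, Finset.mem_univ, true_and, val_sub_eq]
  have hi := i.2
  have hj := j.2
  have hk := k.2
  split_ifs <;> omega

theorem mem_cyclicIco_iff_cyc {i j k : Fin n} (hij : i ≠ j) :
    k ∈ cyclicIco i j ↔ k = i ∨ Cyc i k j := by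
  rw [mem_cyclicIco_iff]; unfold Cyc; omega

/-- The rectangle `[a, b] × [x a, x b]` has no point of `x` in its interior. -/
def IsEmptyRect (x : GridState n) (a b : Fin n) : Prop :=
  ∀ k, ¬ (Cyc a k b ∧ Cyc (x a) (x k) (x b))

theorem forall_iff_of_three {P : Fin n → Prop} (a b c : Fin n) :
    (∀ k, P k) ↔ P a ∧ P b ∧ P c ∧ ∀ k, k ≠ a → k ≠ b → k ≠ c → P k := by
  refine ⟨fun h => ⟨h a, h b, h c, fun k _ _ _ => h k⟩, fun ⟨ha, hb, hc, h⟩ k => ?_⟩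
  by_cases h1 : k = a
  · exact h1 ▸ ha
  by_cases h2 : k = b
  · exact h2 ▸ hb
  by_cases h3 : k = c
  · exact h3 ▸ hc
  exact h k h1 h2 h3

section Three

variable (x : GridState n) {a b c : Fin n}

theorem mul_swap_left (a b : Fin n) : (x * Equiv.swap a b) a = x b := by simp
theorem mul_swap_right (a b : Fin n) : (x * Equiv.swap a b) b = x a := by simp
theorem mul_swap_of_ne {k : Fin n} (ha : k ≠ a) (hb : k ≠ b) : (x * Equiv.swap a b) k = x k := by
  simp [Equiv.swap_apply_of_ne_of_ne ha hb]

theorem Cyc.simps {a b c : Fin n} (h : Cyc a b c) : Cyc a b c ∧ Cyc b c a ∧ Cyc c a b ∧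
    ¬ Cyc a c b ∧ ¬ Cyc c b a ∧ ¬ Cyc b a c ∧ a ≠ b ∧ b ≠ a ∧ b ≠ c ∧ c ≠ b ∧ a ≠ c ∧ c ≠ a :=
  ⟨h, h.rotate, h.rotate.rotate, h.not_swap, h.rotate.rotate.not_swap, h.rotate.not_swap,
    h.ne.1, h.ne.1.symm, h.ne.2.1, h.ne.2.1.symm, h.ne.2.2, h.ne.2.2.symm⟩

set_option linter.unusedSimpArgs false

/-- An L-shaped region with its vertical sides on three circles is cut into two rectangles in two
ways, and both ways give empty rectangles under the same conditions. This lemma and the next three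
treat the four positions of the reflex corner. -/
theorem isEmptyRect_ab_bc_iff_bc_ac (h : Cyc a b c) (hx : Cyc (x a) (x b) (x c)) :
    (IsEmptyRect x a b ∧ IsEmptyRect (x * Equiv.swap a b) b c) ↔
      (IsEmptyRect x b c ∧ IsEmptyRect (x * Equiv.swap b c) a c) := by
  obtain ⟨h1, h2, h3, h4, h5, h6, h7, h8, h9, h10, h11, h12⟩ := h.simps
  obtain ⟨g1, g2, g3, g4, g5, g6, -⟩ := hx.simps
  simp only [IsEmptyRect, ← forall_and]
  rw [forall_iff_of_three a b c, forall_iff_of_three (P := fun k => _ ∧ _) a b c]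
  simp +contextual only [mul_swap_left, mul_swap_right, mul_swap_of_ne, not_cyc_left,
    not_cyc_right, not_cyc_ends, ne_eq, not_false_eq_true, true_and, and_true, not_true_eq_false,
    false_and, and_false, *]
  refine forall₄_congr fun k ha hb hc => ?_
  rcases h.arcs ha hb hc with h | h | h <;>
    rcases hx.arcs (x.injective.ne ha) (x.injective.ne hb) (x.injective.ne hc) with g | g | g <;>
    simp [h, g]

theorem isEmptyRect_ab_bc_iff_ac_ab (h : Cyc a b c) (hx : Cyc (x a) (x c) (x b)) :
    (IsEmptyRect x a b ∧ IsEmptyRect (x * Equiv.swap a b) b c) ↔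
      (IsEmptyRect x a c ∧ IsEmptyRect (x * Equiv.swap a c) a b) := by
  obtain ⟨h1, h2, h3, h4, h5, h6, h7, h8, h9, h10, h11, h12⟩ := h.simps
  obtain ⟨g1, g2, g3, g4, g5, g6, -⟩ := hx.simps
  simp only [IsEmptyRect, ← forall_and]
  rw [forall_iff_of_three a b c, forall_iff_of_three (P := fun k => _ ∧ _) a b c]
  simp +contextual only [mul_swap_left, mul_swap_right, mul_swap_of_ne, not_cyc_left,
    not_cyc_right, not_cyc_ends, ne_eq, not_false_eq_true, true_and, and_true, not_true_eq_false,
    false_and, and_false, *]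
  refine forall₄_congr fun k ha hb hc => ?_
  rcases h.arcs ha hb hc with h | h | h <;>
    rcases hx.arcs (x.injective.ne ha) (x.injective.ne hc) (x.injective.ne hb) with g | g | g <;>
    simp [h, g]

theorem isEmptyRect_ab_ac_iff_bc_ab (h : Cyc a b c) (hx : Cyc (x a) (x b) (x c)) :
    (IsEmptyRect x a b ∧ IsEmptyRect (x * Equiv.swap a b) a c) ↔
      (IsEmptyRect x b c ∧ IsEmptyRect (x * Equiv.swap b c) a b) := by
  obtain ⟨h1, h2, h3, h4, h5, h6, h7, h8, h9, h10, h11, h12⟩ := h.simps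
  obtain ⟨g1, g2, g3, g4, g5, g6, -⟩ := hx.simps
  simp only [IsEmptyRect, ← forall_and]
  rw [forall_iff_of_three a b c, forall_iff_of_three (P := fun k => _ ∧ _) a b c]
  simp +contextual only [mul_swap_left, mul_swap_right, mul_swap_of_ne, not_cyc_left,
    not_cyc_right, not_cyc_ends, ne_eq, not_false_eq_true, true_and, and_true, not_true_eq_false,
    false_and, and_false, *]
  refine forall₄_congr fun k ha hb hc => ?_
  rcases h.arcs ha hb hc with h | h | h <;>
    rcases hx.arcs (x.injective.ne ha) (x.injective.ne hb) (x.injective.ne hc) with g | g | g <;>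
    simp [h, g]

theorem isEmptyRect_ab_ca_iff_cb_ab (h : Cyc a b c) (hx : Cyc (x a) (x c) (x b)) :
    (IsEmptyRect x a b ∧ IsEmptyRect (x * Equiv.swap a b) c a) ↔
      (IsEmptyRect x c b ∧ IsEmptyRect (x * Equiv.swap c b) a b) := by
  obtain ⟨h1, h2, h3, h4, h5, h6, h7, h8, h9, h10, h11, h12⟩ := h.simps
  obtain ⟨g1, g2, g3, g4, g5, g6, -⟩ := hx.simps
  simp only [IsEmptyRect, ← forall_and]
  rw [forall_iff_of_three a b c, forall_iff_of_three (P := fun k => _ ∧ _) a b c]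
  simp +contextual only [mul_swap_left, mul_swap_right, mul_swap_of_ne, not_cyc_left,
    not_cyc_right, not_cyc_ends, ne_eq, not_false_eq_true, true_and, and_true, not_true_eq_false,
    false_and, and_false, *]
  refine forall₄_congr fun k ha hb hc => ?_
  rcases h.arcs ha hb hc with h | h | h <;>
    rcases hx.arcs (x.injective.ne ha) (x.injective.ne hc) (x.injective.ne hb) with g | g | g <;>
    simp [h, g]

theorem IsEmptyRect.cyc {x : GridState n} {a b c : Fin n} (hx : IsEmptyRect x a b)
    (h : Cyc a c b) : Cyc (x a) (x b) (x c) := by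
  have h1 := cyc_or_cyc (x.injective.ne h.ne.1) (x.injective.ne h.ne.2.1) (x.injective.ne h.ne.2.2)
  exact h1.resolve_left fun h2 => hx c ⟨h, h2⟩

/-- The composites that do not occur: a rectangle from `a` to `b`, followed by one on the columns
`b, c` or `c, a`, when `c` lies between `a` and `b`. -/
theorem not_isEmptyRect_bc (h : Cyc a c b) (h1 : IsEmptyRect x a b) :
    ¬ IsEmptyRect (x * Equiv.swap a b) b c := by
  intro h2
  have := h1.cyc h
  have h3 := h2.cyc h.rotate.rotate
  rw [mul_swap_left, mul_swap_right, mul_swap_of_ne x h.ne.1.symm h.ne.2.1] at h3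
  exact h3.not_swap this

theorem not_isEmptyRect_ca (h : Cyc a c b) (h1 : IsEmptyRect x a b) :
    ¬ IsEmptyRect (x * Equiv.swap a b) c a := by
  intro h2
  have := h1.cyc h
  have h3 := h2.cyc h.rotate
  rw [mul_swap_left, mul_swap_right, mul_swap_of_ne x h.ne.1.symm h.ne.2.1] at h3
  exact h3.not_swap this.rotate.rotate

theorem not_isEmptyRect_cb (h : a ≠ b) (hca : c ≠ a) (hcb : c ≠ b)
    (hx : Cyc (x a) (x c) (x b)) (h1 : IsEmptyRect x a b) :
    ¬ IsEmptyRect (x * Equiv.swap a b) c b := by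
  intro h2
  rcases cyc_or_cyc hca.symm hcb h with h3 | h3
  · exact h1 c ⟨h3, hx⟩
  have h3 := h2.cyc h3.rotate.rotate
  rw [mul_swap_left, mul_swap_right, mul_swap_of_ne x hca hcb] at h3
  exact h3.not_swap hx.rotate

theorem not_isEmptyRect_ac (h : a ≠ b) (hca : c ≠ a) (hcb : c ≠ b)
    (hx : Cyc (x a) (x c) (x b)) (h1 : IsEmptyRect x a b) :
    ¬ IsEmptyRect (x * Equiv.swap a b) a c := by
  intro h2
  rcases cyc_or_cyc hca.symm hcb h with h3 | h3
  · exact h1 c ⟨h3, hx⟩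
  have h3 := h2.cyc h3
  rw [mul_swap_left, mul_swap_right, mul_swap_of_ne x hca hcb] at h3
  exact h3.not_swap hx.rotate.rotate

end Three

/-- Rectangles on disjoint pairs of columns: both orders of composition are empty together. -/
theorem isEmptyRect_disjoint_aux (x : GridState n) {a b c d : Fin n} (hca : c ≠ a) (hcb : c ≠ b)
    (hda : d ≠ a) (hdb : d ≠ b)
    (h : IsEmptyRect x a b) (h' : IsEmptyRect (x * Equiv.swap a b) c d) :
    IsEmptyRect x c d := by
  intro k hk
  have h1 := h c
  have h2 := h d
  have h3 := h' a
  have h4 := h' b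
  have h5 := h' k
  rw [mul_swap_of_ne x hca hcb, mul_swap_of_ne x hda hdb] at h3 h4 h5
  rw [mul_swap_left] at h3
  rw [mul_swap_right] at h4
  by_cases hka : k = a
  · subst hka
    exact h2 ⟨(hk.1.outside (fun h0 => h4 ⟨h0, hk.2⟩) hcb.symm hdb.symm).1,
      (hk.2.outside (fun h0 => h3 ⟨hk.1, h0⟩) (x.injective.ne hcb.symm)
        (x.injective.ne hdb.symm)).1⟩
  by_cases hkb : k = b
  · subst hkb
    exact h1 ⟨(hk.1.outside (fun h0 => h3 ⟨h0, hk.2⟩) hca.symm hda.symm).2.rotate.rotate,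
      (hk.2.outside (fun h0 => h4 ⟨hk.1, h0⟩) (x.injective.ne hca.symm)
        (x.injective.ne hda.symm)).2.rotate.rotate⟩
  rw [mul_swap_of_ne x hka hkb] at h5
  exact h5 hk

theorem swap_commute {a b c d : Fin n} (hca : c ≠ a) (hcb : c ≠ b) (hda : d ≠ a) (hdb : d ≠ b) :
    Equiv.swap c d * Equiv.swap a b = Equiv.swap a b * Equiv.swap c d := by
  rw [Equiv.mul_swap_eq_swap_mul, Equiv.swap_apply_of_ne_of_ne hca.symm hda.symm,
    Equiv.swap_apply_of_ne_of_ne hcb.symm hdb.symm]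

theorem isEmptyRect_disjoint (x : GridState n) {a b c d : Fin n} (hca : c ≠ a) (hcb : c ≠ b)
    (hda : d ≠ a) (hdb : d ≠ b)
    (h : IsEmptyRect x a b ∧ IsEmptyRect (x * Equiv.swap a b) c d) :
    IsEmptyRect x c d ∧ IsEmptyRect (x * Equiv.swap c d) a b := by
  refine ⟨isEmptyRect_disjoint_aux x hca hcb hda hdb h.1 h.2, fun k hk => ?_⟩
  have h1 := h.1 c
  have h2 := h.1 d
  have h3 := h.2 a
  have h4 := h.2 b
  have h5 := h.1 k
  rw [mul_swap_of_ne x hca hcb, mul_swap_of_ne x hda hdb] at h3 h4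
  rw [mul_swap_left] at h3
  rw [mul_swap_right] at h4
  rw [mul_swap_of_ne x hca.symm hda.symm, mul_swap_of_ne x hcb.symm hdb.symm] at hk
  by_cases hkc : k = c
  · subst hkc
    rw [mul_swap_left] at hk
    exact h4 ⟨(hk.1.outside (fun h0 => h2 ⟨h0, hk.2⟩) hda hdb).1,
      (hk.2.outside (fun h0 => h1 ⟨hk.1, h0⟩) (x.injective.ne hca)
        (x.injective.ne hcb)).2.rotate.rotate⟩
  by_cases hkd : k = d
  · subst hkd
    rw [mul_swap_right] at hk
    exact h3 ⟨(hk.1.outside (fun h0 => h1 ⟨h0, hk.2⟩) hca hcb).2.rotate.rotate,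
      (hk.2.outside (fun h0 => h2 ⟨hk.1, h0⟩) (x.injective.ne hda) (x.injective.ne hdb)).1⟩
  rw [mul_swap_of_ne x hkc hkd] at hk
  exact h5 hk

end EmptyRectangles

section WeightedRectangles

/-! ### Sums of rectangles with weights, and their square -/

variable {n : ℕ}

/-- Weights of rectangles `[a, b] × [p, q]` in a ring that need not be commutative. They are
multiplicative under horizontal and vertical subdivision, as products of contributions of the
squares would be; but the contributions of the squares along the vertical circle `j` do not
commute, and the order in which they are multiplied is the one in which the point of the grid state
on the circle `j` passes them: upwards if `j` is the western side, downwards if it is the eastern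
side. -/
structure IsRectWeight {A : Type*} [Ring A] (j : Fin n) (w : Fin n → Fin n → Fin n → Fin n → A) :
    Prop where
  horiz : ∀ {a b c p q}, Cyc a b c → p ≠ q → w a c p q = w b c p q * w a b p q
  horiz' : ∀ {a b c p q}, Cyc a b c → p ≠ q → w a c p q = w a b p q * w b c p q
  vert : ∀ {a b p q r}, a ≠ b → Cyc p q r → b ≠ j → w a b p r = w a b q r * w a b p q
  vert' : ∀ {a b p q r}, a ≠ b → Cyc p q r → a ≠ j → w a b p r = w a b p q * w a b q r
  comm : ∀ {a b c d p q p' q'}, ¬ ((a = j ∨ b = j) ∧ (c = j ∨ d = j)) →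
    w a b p q * w c d p' q' = w c d p' q' * w a b p q

variable {A : Type*} [Ring A]

open Classical in
/-- The matrix with entry `∑ r, w r` in row `y` and column `x`, over the empty rectangles `r` from
`x` to `y`. -/
noncomputable def rectMatrix (w : Fin n → Fin n → Fin n → Fin n → A) :
    Matrix (GridState n) (GridState n) A := fun y x =>
  ∑ a, ∑ b, if a ≠ b ∧ y = x * Equiv.swap a b ∧ IsEmptyRect x a b then w a b (x a) (x b) else 0

open Classical in
/-- The contribution to the square of `rectMatrix w` of a rectangle on the columns `a, b`, followed
by one on the columns `c, d`. -/
noncomputable def pairTerm (w : Fin n → Fin n → Fin n → Fin n → A) (z x : GridState n)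
    (a b c d : Fin n) : A :=
  if a ≠ b ∧ c ≠ d ∧ z = x * Equiv.swap a b * Equiv.swap c d ∧
      (IsEmptyRect x a b ∧ IsEmptyRect (x * Equiv.swap a b) c d) then
    w c d ((x * Equiv.swap a b) c) ((x * Equiv.swap a b) d) * w a b (x a) (x b) else 0

theorem rectMatrix_sq (w : Fin n → Fin n → Fin n → Fin n → A) (z x : GridState n) :
    (rectMatrix w * rectMatrix w) z x = ∑ a, ∑ b, ∑ c, ∑ d, pairTerm w z x a b c d := by
  classical
  simp only [Matrix.mul_apply, rectMatrix, Finset.mul_sum]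
  rw [Finset.sum_comm]
  refine Finset.sum_congr rfl fun a _ => ?_
  rw [Finset.sum_comm]
  refine Finset.sum_congr rfl fun b _ => ?_
  simp only [Finset.sum_mul]
  rw [Finset.sum_comm]
  refine Finset.sum_congr rfl fun c _ => ?_
  rw [Finset.sum_comm]
  refine Finset.sum_congr rfl fun d _ => ?_
  rw [Finset.sum_eq_single (x * Equiv.swap a b)]
  · simp only [pairTerm, ite_mul, mul_ite, zero_mul, mul_zero, ← ite_and]
    refine if_congr ?_ rfl rfl
    tauto
  · intro y _ hy
    simp [hy]
  · simp

section Relations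

variable {j : Fin n} {w : Fin n → Fin n → Fin n → Fin n → A} (hw : IsRectWeight j w)
  (z x : GridState n) {a b c d : Fin n}
include hw

/-- Cutting an L-shaped region into two rectangles in two ways. This lemma and the next three treat
the four positions of the reflex corner. Which of the two rules for vertical subdivision applies
depends on whether the special circle contains a side of the rectangle that is cut; the other
rectangle then commutes with one of the parts, as at most one of the circles `a`, `b`, `c` is
special. -/
theorem pairTerm_ab_bc_eq_bc_ac (h : Cyc a b c) (hx : Cyc (x a) (x b) (x c)) :
    pairTerm w z x a b b c = pairTerm w z x b c a c := by
  obtain ⟨hab, hbc, hac⟩ := h.ne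
  obtain ⟨hpq, hqr, hpr⟩ := hx.ne
  classical
  refine if_congr ?_ ?_ rfl
  · rw [isEmptyRect_ab_bc_iff_bc_ac x h hx, show x * Equiv.swap a b * Equiv.swap b c =
      x * Equiv.swap b c * Equiv.swap a c by
        rw [mul_assoc, mul_assoc, Equiv.mul_swap_eq_swap_mul (Equiv.swap b c),
          Equiv.swap_apply_of_ne_of_ne hab hac, Equiv.swap_apply_right]]
    tauto
  · rw [mul_swap_right, mul_swap_right, mul_swap_of_ne x hac.symm hbc.symm,
      mul_swap_of_ne x hab hac]
    by_cases hj : c = j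
    · rw [hw.vert' hbc hx (by rintro rfl; exact hbc hj.symm), mul_assoc, hw.comm (c := a),
        ← mul_assoc, ← hw.horiz h hpq]
      grind
    · rw [hw.vert hbc hx hj, mul_assoc, ← hw.horiz h hpq, hw.comm]
      grind

theorem pairTerm_ab_bc_eq_ac_ab (h : Cyc a b c) (hx : Cyc (x a) (x c) (x b)) :
    pairTerm w z x a b b c = pairTerm w z x a c a b := by
  obtain ⟨hab, hbc, hac⟩ := h.ne
  obtain ⟨hpr, hrq, hpq⟩ := hx.ne
  classical
  refine if_congr ?_ ?_ rfl
  · rw [isEmptyRect_ab_bc_iff_ac_ab x h hx, show x * Equiv.swap a b * Equiv.swap b c =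
      x * Equiv.swap a c * Equiv.swap a b by
        rw [mul_assoc, mul_assoc, Equiv.mul_swap_eq_swap_mul (Equiv.swap a b),
          Equiv.swap_apply_of_ne_of_ne hac.symm hbc.symm, Equiv.swap_apply_right]]
    tauto
  · rw [mul_swap_right, mul_swap_left, mul_swap_of_ne x hac.symm hbc.symm,
      mul_swap_of_ne x hab.symm hbc]
    by_cases hj : a = j
    · rw [hw.vert hab hx (by grind), ← mul_assoc, hw.comm (c := a), mul_assoc, ← hw.horiz h hpr]
      grind
    · rw [hw.vert' hab hx hj, ← mul_assoc, ← hw.horiz h hpr, hw.comm]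
      grind

theorem pairTerm_ab_ac_eq_bc_ab (h : Cyc a b c) (hx : Cyc (x a) (x b) (x c)) :
    pairTerm w z x a b a c = pairTerm w z x b c a b := by
  obtain ⟨hab, hbc, hac⟩ := h.ne
  obtain ⟨hpq, hqr, hpr⟩ := hx.ne
  classical
  refine if_congr ?_ ?_ rfl
  · rw [isEmptyRect_ab_ac_iff_bc_ab x h hx, show x * Equiv.swap a b * Equiv.swap a c =
      x * Equiv.swap b c * Equiv.swap a b by
        rw [mul_assoc, mul_assoc, Equiv.mul_swap_eq_swap_mul (Equiv.swap a b),
          Equiv.swap_apply_of_ne_of_ne hac.symm hbc.symm, Equiv.swap_apply_left,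
          Equiv.swap_comm a b]]
    tauto
  · rw [mul_swap_left, mul_swap_left, mul_swap_of_ne x hac.symm hbc.symm,
      mul_swap_of_ne x hab hac]
    by_cases hj : a = j
    · rw [hw.horiz h hqr, mul_assoc, ← hw.vert hab hx (by grind), hw.comm]
      grind
    · rw [hw.vert' hab hx hj, mul_assoc, ← hw.horiz' h hqr, hw.comm]
      grind

theorem pairTerm_ab_ca_eq_cb_ab (h : Cyc a b c) (hx : Cyc (x a) (x c) (x b)) :
    pairTerm w z x a b c a = pairTerm w z x c b a b := by
  obtain ⟨hab, hbc, hac⟩ := h.ne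
  obtain ⟨hpr, hrq, hpq⟩ := hx.ne
  classical
  refine if_congr ?_ ?_ rfl
  · rw [isEmptyRect_ab_ca_iff_cb_ab x h hx, show x * Equiv.swap a b * Equiv.swap c a =
      x * Equiv.swap c b * Equiv.swap a b by
        rw [mul_assoc, mul_assoc, Equiv.mul_swap_eq_swap_mul (Equiv.swap a b),
          Equiv.swap_apply_of_ne_of_ne hac.symm hbc.symm, Equiv.swap_apply_left,
          Equiv.swap_comm a b]]
    tauto
  · rw [mul_swap_left, mul_swap_right, mul_swap_of_ne x hac.symm hbc.symm,
      mul_swap_of_ne x hac hab]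
    by_cases hj : b = j
    · rw [hw.vert' hab hx (by grind), ← mul_assoc, hw.comm (a := c), mul_assoc,
        ← hw.horiz' h.rotate.rotate hrq]
      grind
    · rw [hw.vert hab hx hj, ← mul_assoc, ← hw.horiz' h.rotate.rotate hrq, hw.comm]
      grind

theorem pairTerm_disjoint (hca : c ≠ a) (hcb : c ≠ b) (hda : d ≠ a) (hdb : d ≠ b) :
    pairTerm w z x a b c d = pairTerm w z x c d a b := by
  classical
  refine if_congr ?_ ?_ rfl
  · rw [mul_assoc, mul_assoc, swap_commute hca hcb hda hdb,
      show (IsEmptyRect x a b ∧ IsEmptyRect (x * Equiv.swap a b) c d) ↔ _ from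
      ⟨isEmptyRect_disjoint x hca hcb hda hdb,
        isEmptyRect_disjoint x hca.symm hda.symm hcb.symm hdb.symm⟩]
    tauto
  · rw [mul_swap_of_ne x hca hcb, mul_swap_of_ne x hda hdb, mul_swap_of_ne x hca.symm hda.symm,
      mul_swap_of_ne x hcb.symm hdb.symm, hw.comm]
    grind

end Relations

section Sums

theorem sum_rotate {M : Type*} [AddCommMonoid M] (f : Fin n → Fin n → Fin n → M) :
    ∑ a, ∑ b, ∑ c, f b c a = ∑ a, ∑ b, ∑ c, f a b c := by
  rw [Finset.sum_comm]
  exact Finset.sum_congr rfl fun b _ => Finset.sum_comm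

theorem sum_swap_right {M : Type*} [AddCommMonoid M] (f : Fin n → Fin n → Fin n → M) :
    ∑ a, ∑ b, ∑ c, f a c b = ∑ a, ∑ b, ∑ c, f a b c :=
  Finset.sum_congr rfl fun _ _ => Finset.sum_comm

/-- Pairs of pairs of columns, sorted by the number of their common columns. -/
theorem sum_pairs {M : Type*} [AddCommGroup M] (g : Fin n → Fin n → Fin n → Fin n → M)
    (h1 : ∀ a c d, g a a c d = 0) (h2 : ∀ a b c, g a b c c = 0) :
    ∑ a, ∑ b, ∑ c, ∑ d, g a b c d =
      (∑ a, ∑ b, ∑ c, ∑ d, if c ≠ a ∧ c ≠ b ∧ d ≠ a ∧ d ≠ b then g a b c d else 0) +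
      (∑ a, ∑ b, ∑ c, if c ≠ a ∧ c ≠ b then
        g a b b c + g a b c b + g a b a c + g a b c a else 0) +
      ∑ a, ∑ b, (g a b a b + g a b b a) := by
  simp only [← Finset.sum_add_distrib]
  refine Finset.sum_congr rfl fun a _ => Finset.sum_congr rfl fun b _ => ?_
  by_cases hab : a = b
  · subst hab; simp [h1]
  have split : ∀ f : Fin n → M, ∑ c, f c = f a + f b + ∑ c, if c ≠ a ∧ c ≠ b then f c else 0 := by
    intro f
    rw [← Finset.sum_filter, ← Finset.sum_pair hab]
    rw [show (Finset.univ.filter fun c => c ≠ a ∧ c ≠ b) = Finset.univ \ {a, b} by ext; simp]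
    exact (Finset.sum_add_sum_compl _ _).symm
  rw [split]
  simp only [split (fun d => g a b a d), split (fun d => g a b b d)]
  have : ∀ c, (if c ≠ a ∧ c ≠ b then ∑ d, g a b c d else 0) =
      (if c ≠ a ∧ c ≠ b then g a b c a + g a b c b else 0) +
        ∑ d, if c ≠ a ∧ c ≠ b ∧ d ≠ a ∧ d ≠ b then g a b c d else 0 := by
    intro c
    by_cases hc : c ≠ a ∧ c ≠ b
    · simp only [split (fun d => g a b c d)]; simp [hc]
    · rw [if_neg hc, if_neg hc, zero_add, Finset.sum_eq_zero]
      intro d _; rw [if_neg]; tauto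
  simp only [this, Finset.sum_add_distrib, h2]
  have : (∑ c, if c ≠ a ∧ c ≠ b then g a b b c + g a b c b + g a b a c + g a b c a else 0) =
     (∑ c, if c ≠ a ∧ c ≠ b then g a b b c else 0) + (∑ c, if c ≠ a ∧ c ≠ b then g a b a c else 0)
      + (∑ c, if c ≠ a ∧ c ≠ b then g a b c a + g a b c b else 0) := by
    simp only [← Finset.sum_add_distrib]
    refine Finset.sum_congr rfl fun c _ => ?_
    split_ifs
    · abel
    · simp
  rw [this]
  abel

end Sums

section Cancel

variable {j : Fin n} {w : Fin n → Fin n → Fin n → Fin n → A} (hw : IsRectWeight j w)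
  (h2 : ∀ y : A, y + y = 0) (z x : GridState n)
include hw h2

theorem sum_pairTerm_disjoint : (∑ a, ∑ b, ∑ c, ∑ d,
    if c ≠ a ∧ c ≠ b ∧ d ≠ a ∧ d ≠ b then pairTerm w z x a b c d else 0) = 0 := by
  simp only [← Finset.sum_product']
  refine Finset.sum_involution (fun q _ => (q.2.2.1, q.2.2.2, q.1, q.2.1)) ?_ ?_ ?_ ?_
  · rintro ⟨a, b, c, d⟩ -
    dsimp only
    by_cases h : c ≠ a ∧ c ≠ b ∧ d ≠ a ∧ d ≠ b
    · rw [if_pos h, if_pos ⟨h.1.symm, h.2.2.1.symm, h.2.1.symm, h.2.2.2.symm⟩,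
        pairTerm_disjoint hw z x h.1 h.2.1 h.2.2.1 h.2.2.2, h2]
    · rw [if_neg h, if_neg, add_zero]
      tauto
  · rintro ⟨a, b, c, d⟩ - h h'
    simp only [Prod.mk.injEq] at h'
    apply h
    rw [if_neg]
    rintro ⟨h1, -⟩
    exact h1 h'.1
  · simp
  · simp

open Classical in
/-- The composites of two rectangles with exactly one common column cancel in pairs: the two
ways to cut their union, an L-shaped region. -/
theorem sum_pairTerm_of_common_column : (∑ a, ∑ b, ∑ c, if c ≠ a ∧ c ≠ b then
    pairTerm w z x a b b c + pairTerm w z x a b c b + pairTerm w z x a b a c +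
      pairTerm w z x a b c a else 0) = 0 := by
  set α := ∑ a, ∑ b, ∑ c,
    if Cyc a b c ∧ Cyc (x a) (x b) (x c) then pairTerm w z x a b b c else 0 with hα
  set β := ∑ a, ∑ b, ∑ c,
    if Cyc a b c ∧ Cyc (x a) (x c) (x b) then pairTerm w z x a b b c else 0 with hβ
  set γ := ∑ a, ∑ b, ∑ c,
    if Cyc a b c ∧ Cyc (x a) (x b) (x c) then pairTerm w z x a b a c else 0 with hγ
  set δ := ∑ a, ∑ b, ∑ c,
    if Cyc a b c ∧ Cyc (x a) (x c) (x b) then pairTerm w z x a b c a else 0 with hδ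
  have hα' : (∑ a, ∑ b, ∑ c,
      if Cyc a b c ∧ Cyc (x a) (x b) (x c) then pairTerm w z x a b c b else 0) = α := by
    rw [hα, ← sum_rotate fun a b c =>
      if Cyc a b c ∧ Cyc (x a) (x b) (x c) then pairTerm w z x a b c b else 0]
    refine Finset.sum_congr rfl fun a _ => Finset.sum_congr rfl fun b _ =>
      Finset.sum_congr rfl fun c _ => ?_
    by_cases h : Cyc a b c ∧ Cyc (x a) (x b) (x c)
    · rw [if_pos h, if_pos ⟨h.1.rotate, h.2.rotate⟩, pairTerm_ab_bc_eq_bc_ac hw z x h.1 h.2]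
    · rw [if_neg h, if_neg fun h' => h ⟨h'.1.rotate.rotate, h'.2.rotate.rotate⟩]
  have hβ' : (∑ a, ∑ b, ∑ c,
      if Cyc a c b ∧ Cyc (x a) (x b) (x c) then pairTerm w z x a b a c else 0) = β := by
    rw [hβ, ← sum_swap_right fun a b c =>
      if Cyc a c b ∧ Cyc (x a) (x b) (x c) then pairTerm w z x a b a c else 0]
    refine Finset.sum_congr rfl fun a _ => Finset.sum_congr rfl fun b _ =>
      Finset.sum_congr rfl fun c _ => ?_
    by_cases h : Cyc a b c ∧ Cyc (x a) (x c) (x b)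
    · rw [if_pos h, if_pos h, pairTerm_ab_bc_eq_ac_ab hw z x h.1 h.2]
    · rw [if_neg h, if_neg h]
  have hγ' : (∑ a, ∑ b, ∑ c,
      if Cyc a b c ∧ Cyc (x a) (x b) (x c) then pairTerm w z x a b c a else 0) = γ := by
    rw [hγ, ← sum_rotate fun a b c =>
      if Cyc a b c ∧ Cyc (x a) (x b) (x c) then pairTerm w z x a b c a else 0]
    refine Finset.sum_congr rfl fun a _ => Finset.sum_congr rfl fun b _ =>
      Finset.sum_congr rfl fun c _ => ?_
    by_cases h : Cyc a b c ∧ Cyc (x a) (x b) (x c)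
    · rw [if_pos h, if_pos ⟨h.1.rotate, h.2.rotate⟩, pairTerm_ab_ac_eq_bc_ab hw z x h.1 h.2]
    · rw [if_neg h, if_neg fun h' => h ⟨h'.1.rotate.rotate, h'.2.rotate.rotate⟩]
  have hδ' : (∑ a, ∑ b, ∑ c,
      if Cyc a c b ∧ Cyc (x a) (x b) (x c) then pairTerm w z x a b c b else 0) = δ := by
    rw [hδ, ← sum_rotate fun a b c =>
      if Cyc a c b ∧ Cyc (x a) (x b) (x c) then pairTerm w z x a b c b else 0,
      ← sum_swap_right fun a b c =>
      if Cyc b a c ∧ Cyc (x b) (x c) (x a) then pairTerm w z x b c a c else 0]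
    refine Finset.sum_congr rfl fun a _ => Finset.sum_congr rfl fun b _ =>
      Finset.sum_congr rfl fun c _ => ?_
    by_cases h : Cyc a b c ∧ Cyc (x a) (x c) (x b)
    · rw [if_pos h, if_pos ⟨h.1.rotate.rotate, h.2.rotate⟩, pairTerm_ab_ca_eq_cb_ab hw z x h.1 h.2]
    · rw [if_neg h, if_neg fun h' => h ⟨h'.1.rotate, h'.2.rotate.rotate⟩]
  have key : ∀ a b c, (if c ≠ a ∧ c ≠ b then pairTerm w z x a b b c + pairTerm w z x a b c b +
      pairTerm w z x a b a c + pairTerm w z x a b c a else 0) =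
      ((if Cyc a b c ∧ Cyc (x a) (x b) (x c) then pairTerm w z x a b b c else 0) +
       (if Cyc a b c ∧ Cyc (x a) (x c) (x b) then pairTerm w z x a b b c else 0)) +
      ((if Cyc a b c ∧ Cyc (x a) (x b) (x c) then pairTerm w z x a b c b else 0) +
       (if Cyc a c b ∧ Cyc (x a) (x b) (x c) then pairTerm w z x a b c b else 0)) +
      ((if Cyc a b c ∧ Cyc (x a) (x b) (x c) then pairTerm w z x a b a c else 0) +
       (if Cyc a c b ∧ Cyc (x a) (x b) (x c) then pairTerm w z x a b a c else 0)) +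
      ((if Cyc a b c ∧ Cyc (x a) (x b) (x c) then pairTerm w z x a b c a else 0) +
       (if Cyc a b c ∧ Cyc (x a) (x c) (x b) then pairTerm w z x a b c a else 0)) := by
    intro a b c
    by_cases hab : a = b
    · subst hab
      simp [not_cyc_left, not_cyc_ends, pairTerm]
    by_cases hc : c ≠ a ∧ c ≠ b
    · rw [if_pos hc]
      have hpos : ∀ {P : Prop} (t : A) [Decidable P], P → (if P then t else 0) = t :=
        fun t _ h => if_pos h
      have zero : ∀ {c' d'}, ¬ (IsEmptyRect x a b ∧ IsEmptyRect (x * Equiv.swap a b) c' d') →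
          pairTerm w z x a b c' d' = 0 := fun h => if_neg fun h' => h h'.2.2.2
      have z1 : Cyc a c b → pairTerm w z x a b b c = 0 := fun h =>
        zero fun h' => not_isEmptyRect_bc x h h'.1 h'.2
      have z4 : Cyc a c b → pairTerm w z x a b c a = 0 := fun h =>
        zero fun h' => not_isEmptyRect_ca x h h'.1 h'.2
      have z2 : Cyc (x a) (x c) (x b) → pairTerm w z x a b c b = 0 := fun h =>
        zero fun h' => not_isEmptyRect_cb x hab hc.1 hc.2 h h'.1 h'.2
      have z3 : Cyc (x a) (x c) (x b) → pairTerm w z x a b a c = 0 := fun h =>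
        zero fun h' => not_isEmptyRect_ac x hab hc.1 hc.2 h h'.1 h'.2
      rcases cyc_or_cyc hab hc.2.symm hc.1.symm with h | h <;>
      rcases cyc_or_cyc (x.injective.ne hab) (x.injective.ne hc.2.symm) (x.injective.ne hc.1.symm)
        with g | g
      · simp [h, g, h.not_swap, g.not_swap]
      · simp [h, g, h.not_swap, g.not_swap, z2 g, z3 g]
      · simp [h, g, h.not_swap, g.not_swap, z1 h, z4 h]
      · simp [h, g, h.not_swap, g.not_swap, z1 h, z4 h, z2 g, z3 g]
    · rw [if_neg hc]
      have : c = a ∨ c = b := by tauto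
      rcases this with rfl | rfl <;> simp [not_cyc_right, not_cyc_left, not_cyc_ends]
  simp only [key, Finset.sum_add_distrib]
  rw [hα', hβ', hγ', hδ', ← hα, ← hβ, ← hγ, ← hδ]
  calc (α + β) + (α + δ) + (γ + β) + (γ + δ)
      = (α + α) + (β + β) + (γ + γ) + (δ + δ) := by abel
    _ = 0 := by simp [h2]

end Cancel

section Annuli

variable [NeZero n]

theorem val_add_one' (a : Fin n) :
    ((a + 1 : Fin n) : ℕ) = if (a : ℕ) + 1 = n then 0 else (a : ℕ) + 1 := by
  have ha := a.2
  rw [Fin.val_add, Fin.val_one', Nat.add_mod_mod]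
  split_ifs with h
  · rw [h, Nat.mod_self]
  · exact Nat.mod_eq_of_lt (by omega)

theorem forall_not_cyc_iff {a b : Fin n} (hab : a ≠ b) : (∀ k, ¬ Cyc a k b) ↔ b = a + 1 := by
  have h1 := val_add_one' a
  constructor
  · intro h
    by_contra hb
    apply h (a + 1)
    have ha := a.2
    have hb' := b.2
    unfold Cyc
    simp only [Fin.lt_def, Fin.ext_iff] at *
    split_ifs at h1 <;> omega
  · rintro rfl k
    have ha := a.2
    have hk := k.2
    unfold Cyc
    simp only [Fin.lt_def] at *
    split_ifs at h1 <;> omega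

theorem isEmptyRect_vertical (x : GridState n) {a b : Fin n} (hab : a ≠ b) :
    (IsEmptyRect x a b ∧ IsEmptyRect (x * Equiv.swap a b) a b) ↔ b = a + 1 := by
  rw [← forall_not_cyc_iff hab]
  constructor
  · rintro ⟨h1, h2⟩ k hk
    have g1 := h1 k
    have g2 := h2 k
    rw [mul_swap_left, mul_swap_right, mul_swap_of_ne x hk.ne.1.symm hk.ne.2.1] at g2
    rcases cyc_or_cyc (x.injective.ne hk.ne.1) (x.injective.ne hk.ne.2.1)
      (x.injective.ne hab) with g | g
    · exact g1 ⟨hk, g⟩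
    · exact g2 ⟨hk, g.rotate⟩
  · exact fun h => ⟨fun k hk => h k hk.1, fun k hk => h k hk.1⟩

theorem isEmptyRect_horizontal (x : GridState n) {a b : Fin n} (hab : a ≠ b) :
    (IsEmptyRect x a b ∧ IsEmptyRect (x * Equiv.swap a b) b a) ↔ x b = x a + 1 := by
  rw [← forall_not_cyc_iff (x.injective.ne hab)]
  constructor
  · rintro ⟨h1, h2⟩ k hk
    obtain ⟨k, rfl⟩ := x.surjective k
    have ha : k ≠ a := fun h => hk.ne.1 (by rw [h])
    have hb : k ≠ b := fun h => hk.ne.2.1 (by rw [h])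
    have g1 := h1 k
    have g2 := h2 k
    rw [mul_swap_left, mul_swap_right, mul_swap_of_ne x ha hb] at g2
    rcases cyc_or_cyc ha.symm hb hab with g | g
    · exact g1 ⟨g, hk⟩
    · exact g2 ⟨g.rotate, hk⟩
  · refine fun h => ⟨fun k hk => h _ hk.2, fun k hk => h ((x * Equiv.swap a b) k) ?_⟩
    rw [mul_swap_left, mul_swap_right] at hk
    exact hk.2

/-- The square of a sum of weighted rectangles is diagonal: only the annuli of width one and of
height one contribute. -/
theorem rectMatrix_sq_eq {j : Fin n} {w : Fin n → Fin n → Fin n → Fin n → A}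
    (hw : IsRectWeight j w) (h2 : ∀ y : A, y + y = 0) (hn : n ≠ 1) (z x : GridState n) :
    (rectMatrix w * rectMatrix w) z x = if z = x then
      (∑ a, w a (a + 1) (x (a + 1)) (x a) * w a (a + 1) (x a) (x (a + 1))) +
      ∑ p, w (x.symm (p + 1)) (x.symm p) p (p + 1) * w (x.symm p) (x.symm (p + 1)) p (p + 1)
      else 0 := by
  have hne : ∀ a : Fin n, a ≠ a + 1 := by
    intro a h
    have h1 := val_add_one' a
    rw [← h] at h1
    have := a.2
    split_ifs at h1 <;> omega
  rw [rectMatrix_sq,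
    sum_pairs _ (fun a c d => by simp [pairTerm]) (fun a b c => by simp [pairTerm]),
    sum_pairTerm_disjoint hw h2, sum_pairTerm_of_common_column hw h2, zero_add, zero_add]
  by_cases hz : z = x
  · subst hz
    simp only [Finset.sum_add_distrib, if_true]
    congr 1
    · refine Finset.sum_congr rfl fun a _ => ?_
      rw [Finset.sum_eq_single (a + 1)]
      · have := (isEmptyRect_vertical z (hne a)).2 rfl
        rw [pairTerm, if_pos ⟨hne a, hne a, by simp [mul_assoc], this⟩, mul_swap_left,
          mul_swap_right]
      · intro b _ hb
        refine if_neg fun h => hb ((isEmptyRect_vertical z h.1).1 h.2.2.2)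
      · simp
    · rw [← Equiv.sum_comp z fun p =>
        w (z.symm (p + 1)) (z.symm p) p (p + 1) * w (z.symm p) (z.symm (p + 1)) p (p + 1)]
      refine Finset.sum_congr rfl fun a _ => ?_
      have hne' : a ≠ z.symm (z a + 1) := fun h => hne (z a) (by
        conv_lhs => rw [h]
        simp)
      rw [Finset.sum_eq_single (z.symm (z a + 1))]
      · have := (isEmptyRect_horizontal z hne').2 (by simp)
        rw [pairTerm, if_pos ⟨hne', hne'.symm,
          by rw [Equiv.swap_comm _ a]; simp [mul_assoc], this⟩, mul_swap_left, mul_swap_right]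
        simp
      · intro b _ hb
        refine if_neg fun h => hb ?_
        rw [← (isEmptyRect_horizontal z h.1).1 h.2.2.2, Equiv.symm_apply_apply]
      · simp
  · rw [if_neg hz]
    refine Finset.sum_eq_zero fun a _ => Finset.sum_eq_zero fun b _ => ?_
    rw [pairTerm, pairTerm, if_neg, if_neg, add_zero]
    · rintro ⟨-, -, h, -⟩
      rw [Equiv.swap_comm b a] at h
      exact hz (by simpa [mul_assoc] using h)
    · rintro ⟨-, -, h, -⟩
      exact hz (by simpa [mul_assoc] using h)

end Annuli

end WeightedRectangles

section Rows

/-! ### Rows met along a vertical circle -/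

variable {n : ℕ}

theorem cyclicIco_union_compl {a b : Fin n} (h : a ≠ b) :
    cyclicIco a b ∪ cyclicIco b a = Finset.univ := by
  ext k
  rw [Finset.mem_union, mem_cyclicIco_iff, mem_cyclicIco_iff]
  simp only [Finset.mem_univ, iff_true]
  omega

theorem cyclicIco_disjoint_compl {a b : Fin n} :
    Disjoint (cyclicIco a b) (cyclicIco b a) := by
  rw [Finset.disjoint_left]
  intro k
  rw [mem_cyclicIco_iff, mem_cyclicIco_iff]
  omega

variable [NeZero n]

/-- The rows `p, p + 1, …, q - 1`, in the order in which a point moving northward from the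
horizontal circle `p` to the horizontal circle `q` meets them. -/
def rows (p q : Fin n) : List (Fin n) :=
  (List.range ((q - p : Fin n) : ℕ)).map fun m => p + Fin.ofNat n m

/-- All rows, beginning with `p`. -/
def allRows (p : Fin n) : List (Fin n) := (List.range n).map fun m => p + Fin.ofNat n m

theorem ofNat_add (a b : ℕ) : Fin.ofNat n (a + b) = Fin.ofNat n a + Fin.ofNat n b := by
  ext; simp [Fin.val_add]

theorem ofNat_val (a : Fin n) : Fin.ofNat n a = a := by
  ext; simp

theorem val_ofNat_of_lt {m : ℕ} (h : m < n) : ((Fin.ofNat n m : Fin n) : ℕ) = m := by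
  simp [Nat.mod_eq_of_lt h]

theorem range_rows_append (p q : Fin n) (k : ℕ) :
    rows p q ++ (List.range k).map (fun m => q + Fin.ofNat n m) =
      (List.range (((q - p : Fin n) : ℕ) + k)).map fun m => p + Fin.ofNat n m := by
  rw [List.range_add, List.map_append, List.map_map, rows]
  congr 1
  refine List.map_congr_left fun m _ => ?_
  rw [Function.comp_apply, ofNat_add, ofNat_val, ← add_assoc, add_sub_cancel]

theorem rows_append {p q r : Fin n} (h : Cyc p q r) : rows p r = rows p q ++ rows q r := by
  rw [rows.eq_def q r, range_rows_append, rows]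
  congr 2
  simp only [val_sub_eq]
  have := p.2
  have := q.2
  have := r.2
  unfold Cyc at h
  simp only [Fin.lt_def, Fin.le_def] at *
  split_ifs <;> omega

theorem allRows_eq_append {p q : Fin n} (h : p ≠ q) : allRows p = rows p q ++ rows q p := by
  rw [rows.eq_def q p, range_rows_append, allRows]
  congr 2
  simp only [val_sub_eq]
  have := p.2
  have := q.2
  simp only [Fin.ext_iff, ne_eq, Fin.le_def] at *
  split_ifs <;> omega

theorem allRows_eq (p ρ : Fin n) : allRows p = rows p ρ ++ ρ :: rows (ρ + 1) p := by
  have h : (ρ :: rows (ρ + 1) p) = (List.range (((p - (ρ + 1) : Fin n) : ℕ) + 1)).map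
      fun m => ρ + Fin.ofNat n m := by
    rw [List.range_succ_eq_map, List.map_cons, List.map_map, rows]
    congr 1
    · ext; simp
    refine List.map_congr_left fun m _ => ?_
    rw [Function.comp_apply, Nat.succ_eq_add_one, add_comm m, ofNat_add, ← add_assoc]
    rfl
  rw [h, range_rows_append, allRows]
  congr 2
  have h1 := val_add_one' ρ
  simp only [val_sub_eq]
  have := p.2
  have := ρ.2
  simp only [Fin.le_def] at *
  split_ifs at * <;> omega

theorem rows_add_one (p : Fin n) (h : p ≠ p + 1) : rows p (p + 1) = [p] := by
  have h1 := val_add_one' p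
  have : ((p + 1 - p : Fin n) : ℕ) = 1 := by
    simp only [val_sub_eq]
    have := p.2
    simp only [Fin.ext_iff, ne_eq, Fin.le_def] at *
    split_ifs at * <;> omega
  rw [rows, this]
  simp [List.range_succ]

theorem mem_rows {p q h : Fin n} : h ∈ rows p q ↔ h ∈ cyclicIco p q := by
  simp only [rows, cyclicIco, List.mem_map, List.mem_range, Finset.mem_filter, Finset.mem_univ,
    true_and]
  constructor
  · rintro ⟨m, hm, rfl⟩
    rwa [add_sub_cancel_left, val_ofNat_of_lt (hm.trans (Fin.is_lt _))]
  · intro hm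
    exact ⟨_, hm, by rw [ofNat_val, add_sub_cancel]⟩

theorem nodup_rows (p q : Fin n) : (rows p q).Nodup := by
  refine List.Nodup.map_on ?_ List.nodup_range
  intro a ha b hb hab
  rw [List.mem_range] at ha hb
  have := congrArg Fin.val (add_left_cancel hab)
  rwa [val_ofNat_of_lt (ha.trans (Fin.is_lt _)), val_ofNat_of_lt (hb.trans (Fin.is_lt _))] at this

@[to_additive]
theorem prod_rows {M : Type*} [CommMonoid M] (f : Fin n → M) (p q : Fin n) :
    ((rows p q).map f).prod = ∏ h ∈ cyclicIco p q, f h := by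
  rw [← List.prod_toFinset f (nodup_rows p q)]
  congr 1
  ext h
  rw [List.mem_toFinset, mem_rows]

theorem nodup_allRows (p : Fin n) : (allRows p).Nodup := by
  refine List.Nodup.map_on ?_ List.nodup_range
  intro a ha b hb hab
  rw [List.mem_range] at ha hb
  have := congrArg Fin.val (add_left_cancel hab)
  rwa [val_ofNat_of_lt ha, val_ofNat_of_lt hb] at this

theorem mem_allRows (p k : Fin n) : k ∈ allRows p := by
  rw [allRows, List.mem_map]
  exact ⟨_, List.mem_range.2 (k - p).is_lt, by rw [ofNat_val, add_sub_cancel]⟩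

theorem prod_allRows {M : Type*} [CommMonoid M] (f : Fin n → M) (p : Fin n) :
    ((allRows p).map f).prod = ∏ h, f h := by
  rw [← List.prod_toFinset f (nodup_allRows p)]
  congr 1
  ext k
  simp [mem_allRows]

theorem cyclicIco_add_one (a : Fin n) (h : a ≠ a + 1) : cyclicIco a (a + 1) = {a} := by
  ext k
  rw [← mem_rows, rows_add_one a h]
  simp

theorem cyclicIco_union {a b c : Fin n} (h : Cyc a b c) :
    cyclicIco a c = cyclicIco a b ∪ cyclicIco b c := by
  ext k
  rw [Finset.mem_union, ← mem_rows, ← mem_rows, ← mem_rows, rows_append h, List.mem_append]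

theorem cyclicIco_disjoint {a b c : Fin n} (h : Cyc a b c) :
    Disjoint (cyclicIco a b) (cyclicIco b c) := by
  have := nodup_rows a c
  rw [rows_append h, List.nodup_append'] at this
  rw [Finset.disjoint_left]
  intro k h1 h2
  exact this.2.2 (mem_rows.2 h1) (mem_rows.2 h2)

end Rows

section Holonomy

/-! ### Weights with holonomy along one vertical circle -/

variable {n : ℕ} [NeZero n] {R A : Type*} [CommRing R] [Ring A] [Algebra R A]

/-- The ordered product of the factors `U h` over the rows `h` of a list, the first one acting
first. -/
def upProd (U : Fin n → A) (l : List (Fin n)) : A := (l.reverse.map U).prod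

/-- The ordered product of the factors `D h` over the rows `h` of a list, the last one acting
first. -/
def downProd (D : Fin n → A) (l : List (Fin n)) : A := (l.map D).prod

omit [NeZero n] in
theorem upProd_append (U : Fin n → A) (l l' : List (Fin n)) :
    upProd U (l ++ l') = upProd U l' * upProd U l := by simp [upProd]

omit [NeZero n] in
theorem downProd_append (D : Fin n → A) (l l' : List (Fin n)) :
    downProd D (l ++ l') = downProd D l * downProd D l' := by simp [downProd]

omit [NeZero n] in
theorem upProd_cons (U : Fin n → A) (h : Fin n) (l : List (Fin n)) :
    upProd U (h :: l) = upProd U l * U h := by simp [upProd]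

omit [NeZero n] in
theorem downProd_cons (D : Fin n → A) (h : Fin n) (l : List (Fin n)) :
    downProd D (h :: l) = D h * downProd D l := by simp [downProd]

/-- The data of a weight: the weights `ω c h` of the squares, and for the circle `j` between the
columns `i` and `j` a factor `U h` for passing the row `h` upwards (with the rectangle to the
east) and a factor `D h` for passing it downwards (with the rectangle to the west). Passing a row
in both directions gives the weight of both squares. -/
structure HolonomyData (n : ℕ) [NeZero n] (R A : Type*) [CommRing R] [Ring A] [Algebra R A] where
  i : Fin n
  j : Fin n
  j_eq : j = i + 1
  i_ne_j : i ≠ j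
  ω : Fin n → Fin n → R
  U : Fin n → A
  D : Fin n → A
  U_mul_D : ∀ h, U h * D h = algebraMap R A (ω i h * ω j h)
  D_mul_U : ∀ h, D h * U h = algebraMap R A (ω i h * ω j h)

namespace HolonomyData

variable (H : HolonomyData n R A)

/-- The product of the weights of the squares outside the columns `i` and `j`. -/
def scalarPart (a b p q : Fin n) : R :=
  ∏ c ∈ (cyclicIco a b).filter fun c => c ≠ H.i ∧ c ≠ H.j, ((rows p q).map (H.ω c)).prod

/-- The contribution of the columns `i` and `j`: only the factors along the circle `j` if this is
a side of the rectangle. -/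
def sidePart (a b p q : Fin n) : A :=
  if a = H.j then upProd H.U (rows p q)
  else if b = H.j then downProd H.D (rows p q)
  else if H.j ∈ cyclicIco a b then
    algebraMap R A ((rows p q).map fun h => H.ω H.i h * H.ω H.j h).prod
  else 1

/-- The weight of the rectangle `[a, b] × [p, q]`. -/
def weight (a b p q : Fin n) : A := H.scalarPart a b p q • H.sidePart a b p q

theorem down_mul_up (l : List (Fin n)) : downProd H.D l * upProd H.U l =
    algebraMap R A (l.map fun h => H.ω H.i h * H.ω H.j h).prod := by
  induction l with
  | nil => simp [downProd, upProd]
  | cons h l ih =>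
    rw [downProd_cons, upProd_cons, mul_assoc, ← mul_assoc _ _ (H.U h), ih, Algebra.commutes,
      ← mul_assoc, H.D_mul_U, ← map_mul, List.map_cons, List.prod_cons]

theorem up_mul_down (l : List (Fin n)) : upProd H.U l * downProd H.D l =
    algebraMap R A (l.map fun h => H.ω H.i h * H.ω H.j h).prod := by
  induction l with
  | nil => simp [downProd, upProd]
  | cons h l ih =>
    rw [downProd_cons, upProd_cons, mul_assoc, ← mul_assoc (H.U h), H.U_mul_D,
      Algebra.commutes, ← mul_assoc, ih, ← map_mul, List.map_cons, List.prod_cons, mul_comm]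

theorem sidePart_left (b p q : Fin n) : H.sidePart H.j b p q = upProd H.U (rows p q) :=
  if_pos rfl

theorem sidePart_right {a : Fin n} (h : a ≠ H.j) (p q : Fin n) :
    H.sidePart a H.j p q = downProd H.D (rows p q) := by
  rw [sidePart, if_neg h, if_pos rfl]

theorem sidePart_of_cyc {a b : Fin n} (h : Cyc a H.j b) (p q : Fin n) :
    H.sidePart a b p q = algebraMap R A ((rows p q).map fun h => H.ω H.i h * H.ω H.j h).prod := by
  rw [sidePart, if_neg h.ne.1, if_neg h.ne.2.1.symm, if_pos]
  exact (mem_cyclicIco_iff_cyc h.ne.2.2).2 (Or.inr h)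

theorem sidePart_of_not_cyc {a b : Fin n} (hab : a ≠ b) (ha : a ≠ H.j) (hb : b ≠ H.j)
    (h : ¬ Cyc a H.j b) (p q : Fin n) : H.sidePart a b p q = 1 := by
  rw [sidePart, if_neg ha, if_neg hb, if_neg]
  rw [mem_cyclicIco_iff_cyc hab]
  exact fun h' => h'.elim (fun e => ha e.symm) h

theorem sidePart_central {a b : Fin n} (ha : a ≠ H.j) (hb : b ≠ H.j) (p q : Fin n) (y : A) :
    H.sidePart a b p q * y = y * H.sidePart a b p q := by
  rw [sidePart, if_neg ha, if_neg hb]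
  split_ifs
  · exact Algebra.commutes _ _
  · rw [one_mul, mul_one]

theorem sidePart_horiz {a b c : Fin n} (h : Cyc a b c) (p q : Fin n) :
    H.sidePart a c p q = H.sidePart b c p q * H.sidePart a b p q ∧
      H.sidePart a c p q = H.sidePart a b p q * H.sidePart b c p q := by
  obtain ⟨hab, hbc, hac⟩ := h.ne
  by_cases ha : a = H.j
  · subst ha
    rw [H.sidePart_left, H.sidePart_left, H.sidePart_of_not_cyc hbc hab.symm hac.symm
      h.rotate.not_swap]
    simp
  by_cases hb : b = H.j
  · subst hb
    rw [H.sidePart_left, H.sidePart_right hab, H.sidePart_of_cyc h, up_mul_down, down_mul_up]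
    simp
  by_cases hc : c = H.j
  · subst hc
    rw [H.sidePart_right hac, H.sidePart_right hbc, H.sidePart_of_not_cyc hab hac hbc
      h.not_swap]
    simp
  rcases h.arcs (Ne.symm ha) (Ne.symm hb) (Ne.symm hc) with g | g | g
  · rw [H.sidePart_of_cyc g.1, H.sidePart_of_not_cyc hbc hb hc g.2.1,
      H.sidePart_of_cyc g.2.2.2.1]
    simp
  · rw [H.sidePart_of_cyc g.2.1, H.sidePart_of_not_cyc hab ha hb g.1,
      H.sidePart_of_cyc g.2.2.2.1]
    simp
  · rw [H.sidePart_of_not_cyc hbc hb hc g.2.1, H.sidePart_of_not_cyc hab ha hb g.1,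
      H.sidePart_of_not_cyc hac ha hc g.2.2.2.1]
    simp

theorem scalarPart_horiz {a b c : Fin n} (h : Cyc a b c) (p q : Fin n) :
    H.scalarPart a c p q = H.scalarPart a b p q * H.scalarPart b c p q := by
  rw [scalarPart, cyclicIco_union h, Finset.filter_union, Finset.prod_union]
  · rfl
  · exact Finset.disjoint_filter_filter (cyclicIco_disjoint h)

theorem scalarPart_vert (a b : Fin n) {p q r : Fin n} (h : Cyc p q r) :
    H.scalarPart a b p r = H.scalarPart a b p q * H.scalarPart a b q r := by
  simp only [scalarPart, ← Finset.prod_mul_distrib, rows_append h, List.map_append,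
    List.prod_append]

theorem isRectWeight : IsRectWeight H.j H.weight where
  horiz h _ := by
    rw [weight, weight, weight, smul_mul_smul_comm, H.scalarPart_horiz h,
      (H.sidePart_horiz h _ _).1, mul_comm (H.scalarPart _ _ _ _)]
  horiz' h _ := by
    rw [weight, weight, weight, smul_mul_smul_comm, H.scalarPart_horiz h,
      (H.sidePart_horiz h _ _).2]
  vert {a b p q r} hab h hb := by
    rw [weight, weight, weight, smul_mul_smul_comm, H.scalarPart_vert _ _ h,
      mul_comm (H.scalarPart _ _ _ _)]
    congr 1
    rw [sidePart, sidePart, sidePart, if_neg hb, if_neg hb, if_neg hb, rows_append h]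
    split_ifs
    · rw [upProd_append]
    · rw [List.map_append, List.prod_append, map_mul, Algebra.commutes]
    · rw [one_mul]
  vert' {a b p q r} hab h ha := by
    rw [weight, weight, weight, smul_mul_smul_comm, H.scalarPart_vert _ _ h]
    congr 1
    rw [sidePart, sidePart, sidePart, if_neg ha, if_neg ha, if_neg ha, rows_append h]
    split_ifs
    · rw [downProd_append]
    · rw [List.map_append, List.prod_append, map_mul]
    · rw [one_mul]
  comm {a b c d p q p' q'} h := by
    rw [weight, weight, smul_mul_smul_comm, smul_mul_smul_comm, mul_comm (H.scalarPart _ _ _ _)]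
    congr 1
    by_cases h1 : a = H.j ∨ b = H.j
    · have h2 : ¬ (c = H.j ∨ d = H.j) := fun h2 => h ⟨h1, h2⟩
      rw [not_or] at h2
      rw [H.sidePart_central h2.1 h2.2]
    · rw [not_or] at h1
      rw [H.sidePart_central h1.1 h1.2]

/-- The square of the matrix of weighted rectangles: in characteristic two, when all annuli of
width or height one have the same weight `κ`, what remains are the two annuli on both sides
of the circle `j`. -/
theorem rectMatrix_sq (h2 : ∀ y : A, y + y = 0) (κ : R)
    (hcol : ∀ c, ∏ h, H.ω c h = κ) (hrow : ∀ h, ∏ c, H.ω c h = κ) (z x : GridState n) :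
    (rectMatrix H.weight * rectMatrix H.weight) z x = if z = x then
      upProd H.U (allRows (x H.j)) + downProd H.D (allRows (x H.j)) else 0 := by
  have hij := H.i_ne_j
  have hn : n ≠ 1 := by
    rintro rfl
    exact hij (Subsingleton.elim _ _)
  have hne : ∀ a : Fin n, a ≠ a + 1 := by
    intro a h
    have h1 := val_add_one' a
    rw [← h] at h1
    have := a.2
    split_ifs at h1 <;> omega
  rw [rectMatrix_sq_eq H.isRectWeight h2 hn]
  refine if_congr Iff.rfl ?_ rfl
  have hvert : ∀ a, H.weight a (a + 1) (x (a + 1)) (x a) * H.weight a (a + 1) (x a) (x (a + 1)) =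
      if a = H.j then upProd H.U (allRows (x H.j)) else
      if a = H.i then downProd H.D (allRows (x H.j)) else algebraMap R A κ := by
    intro a
    have hx : x a ≠ x (a + 1) := x.injective.ne (hne a)
    rw [weight, weight, smul_mul_smul_comm]
    split_ifs with h1 h3
    · subst h1
      rw [sidePart_left, sidePart_left, ← upProd_append, ← allRows_eq_append hx, scalarPart,
        scalarPart, cyclicIco_add_one _ (hne _)]
      simp [Finset.filter_singleton]
    · subst h3
      rw [← H.j_eq, H.sidePart_right hij, H.sidePart_right hij, ← downProd_append,
        ← allRows_eq_append (x.injective.ne hij.symm), scalarPart, scalarPart, H.j_eq,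
        cyclicIco_add_one _ (hne _)]
      simp [Finset.filter_singleton]
    · have h4 : a + 1 ≠ H.j := by
        rw [H.j_eq]
        exact fun h => h3 (add_right_cancel h)
      have h5 : ¬ Cyc a H.j (a + 1) := (forall_not_cyc_iff (hne a)).2 rfl _
      rw [H.sidePart_of_not_cyc (hne a) h1 h4 h5, H.sidePart_of_not_cyc (hne a) h1 h4 h5,
        scalarPart, scalarPart, cyclicIco_add_one _ (hne _), Finset.filter_singleton,
        if_pos ⟨h3, h1⟩, Finset.prod_singleton, Finset.prod_singleton, mul_one,
        Algebra.algebraMap_eq_smul_one, ← List.prod_append, ← List.map_append,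
        ← allRows_eq_append hx.symm, prod_allRows, hcol]
  have hhor : ∀ p, H.weight (x.symm (p + 1)) (x.symm p) p (p + 1) *
      H.weight (x.symm p) (x.symm (p + 1)) p (p + 1) = algebraMap R A κ := by
    intro p
    set a := x.symm p
    set b := x.symm (p + 1)
    have hab : a ≠ b := x.symm.injective.ne (hne p)
    have hside : H.sidePart b a p (p + 1) * H.sidePart a b p (p + 1) =
        algebraMap R A (H.ω H.i p * H.ω H.j p) := by
      by_cases ha : a = H.j
      · rw [ha, H.sidePart_left, H.sidePart_right (ha ▸ hab.symm), rows_add_one _ (hne p)]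
        simp [upProd, downProd, H.D_mul_U]
      by_cases hb : b = H.j
      · rw [hb, H.sidePart_left, H.sidePart_right ha, rows_add_one _ (hne p)]
        simp [upProd, downProd, H.U_mul_D]
      rcases cyc_or_cyc ha (Ne.symm hb) hab with g | g
      · rw [H.sidePart_of_cyc g, H.sidePart_of_not_cyc hab.symm hb ha g.rotate.rotate.not_swap,
          rows_add_one _ (hne p)]
        simp
      · rw [H.sidePart_of_cyc g.rotate, H.sidePart_of_not_cyc hab ha hb g.not_swap,
          rows_add_one _ (hne p)]
        simp
    rw [weight, weight, smul_mul_smul_comm, hside, scalarPart, scalarPart,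
      ← Finset.prod_union (Finset.disjoint_filter_filter cyclicIco_disjoint_compl),
      ← Finset.filter_union, cyclicIco_union_compl hab.symm, ← hrow p,
      Algebra.smul_def, ← map_mul, rows_add_one _ (hne p)]
    congr 1
    rw [← Finset.prod_filter_mul_prod_filter_not Finset.univ (fun c => c ≠ H.i ∧ c ≠ H.j)]
    have : (Finset.univ.filter fun c => ¬ (c ≠ H.i ∧ c ≠ H.j)) = {H.i, H.j} := by
      ext c; simp; tauto
    rw [this, Finset.prod_pair hij]
    simp
  simp only [hhor, ← Finset.sum_add_distrib]
  have hsum : ∀ a, H.weight a (a + 1) (x (a + 1)) (x a) * H.weight a (a + 1) (x a) (x (a + 1)) +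
      algebraMap R A κ =
      (if a = H.j then upProd H.U (allRows (x H.j)) + algebraMap R A κ else 0) +
      if a = H.i then downProd H.D (allRows (x H.j)) + algebraMap R A κ else 0 := by
    intro a
    rw [hvert]
    by_cases h1 : a = H.j
    · subst h1
      simp [hij.symm]
    · by_cases h3 : a = H.i <;> simp [h1, h3, h2, hij]
  simp only [hsum, Finset.sum_add_distrib, Finset.sum_ite_eq', Finset.mem_univ, if_true]
  rw [add_add_add_comm, h2, add_zero]

end HolonomyData

end Holonomy

section Zigzag

/-! ### The zigzag algebra -/

/-- Lower triangular matrices of size four whose rows and columns stand alternately for two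
objects, so that entries two steps further down the diagonal agree (next to the diagonal, this is
required only for the entries which are used twice). The entry `(1, 0)` is a map from the first
object to the second, `(2, 1)` is a map back, `(2, 0)` and `(3, 1)` are endomorphisms of the
objects, related to the two composites of these maps. -/
def zigzag (R : Type*) [CommRing R] : Subalgebra R (Matrix (Fin 4) (Fin 4) R) where
  carrier := {N | (∀ k l, k < l → N k l = 0) ∧ N 2 2 = N 0 0 ∧ N 3 3 = N 1 1 ∧ N 3 2 = N 1 0}
  mul_mem' := by
    rintro M N ⟨hM, hM2, hM3, hM4⟩ ⟨hN, hN2, hN3, hN4⟩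
    refine ⟨fun k l hkl => ?_, ?_, ?_, ?_⟩
    · rw [Matrix.mul_apply]
      refine Finset.sum_eq_zero fun m _ => ?_
      rcases lt_or_ge k m with h | h
      · rw [hM k m h, zero_mul]
      · rw [hN m l (h.trans_lt hkl), mul_zero]
    all_goals
      have h1 := hM 0 1 (by decide)
      have h2 := hM 0 2 (by decide)
      have h3 := hM 0 3 (by decide)
      have h4 := hM 1 2 (by decide)
      have h5 := hM 1 3 (by decide)
      have h6 := hM 2 3 (by decide)
      have g1 := hN 0 1 (by decide)
      have g2 := hN 0 2 (by decide)
      have g3 := hN 0 3 (by decide)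
      have g4 := hN 1 2 (by decide)
      have g5 := hN 1 3 (by decide)
      have g6 := hN 2 3 (by decide)
      simp only [Matrix.mul_apply, Fin.sum_univ_four, *]
      ring
  add_mem' := by
    rintro M N ⟨hM, hM2, hM3, hM4⟩ ⟨hN, hN2, hN3, hN4⟩
    refine ⟨fun k l hkl => ?_, ?_, ?_, ?_⟩ <;> simp [*]
  algebraMap_mem' r := by
    refine ⟨fun k l hkl => ?_, ?_, ?_, ?_⟩ <;> simp [Matrix.algebraMap_matrix_apply]
    exact fun h => absurd h hkl.ne

namespace zigzag

variable {R : Type*} [CommRing R]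

theorem entries_mul (M N : zigzag R) :
    (M * N).1 0 0 = M.1 0 0 * N.1 0 0 ∧ (M * N).1 1 1 = M.1 1 1 * N.1 1 1 ∧
    (M * N).1 1 0 = M.1 1 0 * N.1 0 0 + M.1 1 1 * N.1 1 0 ∧
    (M * N).1 2 1 = M.1 2 1 * N.1 1 1 + M.1 0 0 * N.1 2 1 ∧
    (M * N).1 2 0 = M.1 2 0 * N.1 0 0 + M.1 2 1 * N.1 1 0 + M.1 0 0 * N.1 2 0 ∧
    (M * N).1 3 1 = M.1 3 1 * N.1 1 1 + M.1 1 0 * N.1 2 1 + M.1 1 1 * N.1 3 1 := by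
  obtain ⟨M, hM, hM2, hM3, hM4⟩ := M
  obtain ⟨N, hN, hN2, hN3, hN4⟩ := N
  have h1 := hM 0 1 (by decide)
  have h2 := hM 0 2 (by decide)
  have h3 := hM 0 3 (by decide)
  have h4 := hM 1 2 (by decide)
  have h5 := hM 1 3 (by decide)
  have h6 := hM 2 3 (by decide)
  have g1 := hN 0 1 (by decide)
  have g2 := hN 0 2 (by decide)
  have g3 := hN 0 3 (by decide)
  have g4 := hN 1 2 (by decide)
  have g5 := hN 1 3 (by decide)
  have g6 := hN 2 3 (by decide)
  refine ⟨?_, ?_, ?_, ?_, ?_, ?_⟩ <;>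
    simp [Matrix.mul_apply, Fin.sum_univ_four, *]

/-- The entry `(k, l)`, as a linear map. -/
def entry (k l : Fin 4) : zigzag R →ₗ[R] R where
  toFun N := N.1 k l
  map_add' _ _ := rfl
  map_smul' _ _ := rfl

/-- The diagonal entry of the first object. -/
def diag₀ : zigzag R →ₐ[R] R :=
  AlgHom.ofLinearMap (entry 0 0) rfl fun M N => (entries_mul M N).1

/-- The diagonal entry of the second object. -/
def diag₁ : zigzag R →ₐ[R] R :=
  AlgHom.ofLinearMap (entry 1 1) rfl fun M N => (entries_mul M N).2.1

/-- The diagonal matrix with entries `e` and `f` for the two objects. -/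
def ofDiag (e f : R) : zigzag R :=
  ⟨Matrix.diagonal ![e, f, e, f], fun _ _ h => Matrix.diagonal_apply_ne _ h.ne, rfl, rfl, rfl⟩

/-- Passing upwards a row with factors `e` and `f`, with transitions from the first to the second
object at the beginning and from the second to the first object at the end. -/
def upStep (e f : R) : zigzag R :=
  ⟨!![e, 0, 0, 0; f, f, 0, 0; f, f, e, 0; 0, 0, f, f], by
    intro k l h
    fin_cases k <;> fin_cases l <;> first | rfl | exact absurd h (by decide), rfl, rfl, rfl⟩

/-- Passing the row of `upStep` downwards, where the transitions are met in the reverse order. -/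
def downStep (e f : R) : zigzag R :=
  ⟨!![e, 0, 0, 0; e, f, 0, 0; 0, e, e, 0; 0, e, e, f], by
    intro k l h
    fin_cases k <;> fin_cases l <;> first | rfl | exact absurd h (by decide), rfl, rfl, rfl⟩

theorem ofDiag_mul (e f e' f' : R) : ofDiag e f * ofDiag e' f' = ofDiag (e * e') (f * f') := by
  apply Subtype.ext
  refine (Matrix.diagonal_mul_diagonal _ _).trans (congrArg Matrix.diagonal ?_)
  ext k
  fin_cases k <;> rfl

theorem ofDiag_mul_mul (e f e' f' : R) (N : zigzag R) (k l : Fin 4) :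
    (ofDiag e f * N * ofDiag e' f').1 k l = ![e, f, e, f] k * N.1 k l * ![e', f', e', f'] l := by
  refine (Matrix.mul_diagonal _ _ _ _).trans ?_
  congr 1
  exact Matrix.diagonal_mul _ _ _ _

theorem ofDiag_self (e : R) : ofDiag e e = algebraMap R (zigzag R) e := by
  apply Subtype.ext
  show Matrix.diagonal _ = algebraMap R (Matrix (Fin 4) (Fin 4) R) e
  rw [Matrix.algebraMap_eq_diagonal]
  congr 1
  ext k
  fin_cases k <;> rfl

theorem upStep_mul_downStep (h2 : ∀ y : R, y + y = 0) (e f : R) :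
    upStep e f * downStep f e = algebraMap R (zigzag R) (f * e) := by
  apply Subtype.ext
  show _ = algebraMap R (Matrix (Fin 4) (Fin 4) R) (f * e)
  ext k l
  fin_cases k <;> fin_cases l <;>
    simp [upStep, downStep, Matrix.mul_apply, Fin.sum_univ_four, Matrix.algebraMap_matrix_apply,
      h2, mul_comm e f]

theorem downStep_mul_upStep (h2 : ∀ y : R, y + y = 0) (e f : R) :
    downStep f e * upStep e f = algebraMap R (zigzag R) (f * e) := by
  apply Subtype.ext
  show _ = algebraMap R (Matrix (Fin 4) (Fin 4) R) (f * e)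
  ext k l
  fin_cases k <;> fin_cases l <;>
    simp [upStep, downStep, Matrix.mul_apply, Fin.sum_univ_four, Matrix.algebraMap_matrix_apply,
      h2, mul_comm e f]

end zigzag

/-! ### The holonomy of a cross-commutation -/

section Crossing

variable {n : ℕ} [NeZero n] {R : Type*} [CommRing R]

open zigzag in
/-- The two objects of the zigzag stand for the two positions of the circle between the columns
`i` and `j`: the markings of `j` lie to the east of the first and to the west of the second
position, and conversely for those of `i`. The two curves meet at the lower and at the upper
end of the row `ρ`. -/
def crossingData (h2 : ∀ y : R, y + y = 0) (ω : Fin n → Fin n → R) (i j ρ : Fin n)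
    (hj : j = i + 1) (hij : i ≠ j) : HolonomyData n R (zigzag R) where
  i := i
  j := j
  j_eq := hj
  i_ne_j := hij
  ω := ω
  U h := if h = ρ then upStep (ω j h) (ω i h) else ofDiag (ω j h) (ω i h)
  D h := if h = ρ then downStep (ω i h) (ω j h) else ofDiag (ω i h) (ω j h)
  U_mul_D h := by
    split_ifs
    · exact upStep_mul_downStep h2 _ _
    · rw [ofDiag_mul, mul_comm (ω i h), ofDiag_self]
  D_mul_U h := by
    split_ifs
    · exact downStep_mul_upStep h2 _ _
    · rw [ofDiag_mul, mul_comm (ω j h), ofDiag_self]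

variable (h2 : ∀ y : R, y + y = 0) (ω : Fin n → Fin n → R) (i j ρ : Fin n)
    (hj : j = i + 1) (hij : i ≠ j)

theorem upProd_of_notMem (l : List (Fin n)) (hl : ρ ∉ l) :
    upProd (crossingData h2 ω i j ρ hj hij).U l =
      zigzag.ofDiag (l.map (ω j)).prod (l.map (ω i)).prod := by
  induction l with
  | nil => simp [upProd, zigzag.ofDiag_self]
  | cons h l ih =>
    rw [List.mem_cons, not_or] at hl
    rw [upProd_cons, ih hl.2, List.map_cons, List.map_cons, List.prod_cons, List.prod_cons,
      mul_comm, mul_comm (ω i h), ← zigzag.ofDiag_mul]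
    simp [crossingData, Ne.symm hl.1]

theorem downProd_of_notMem (l : List (Fin n)) (hl : ρ ∉ l) :
    downProd (crossingData h2 ω i j ρ hj hij).D l =
      zigzag.ofDiag (l.map (ω i)).prod (l.map (ω j)).prod := by
  induction l with
  | nil => simp [downProd, zigzag.ofDiag_self]
  | cons h l ih =>
    rw [List.mem_cons, not_or] at hl
    rw [downProd_cons, ih hl.2, List.map_cons, List.map_cons, List.prod_cons, List.prod_cons,
      ← zigzag.ofDiag_mul]
    simp [crossingData, Ne.symm hl.1]

/-- The two annuli along the circle: the maps between the two objects vanish, and on each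
object only one of the annuli contributes. -/
theorem annuli_entries (p : Fin n) :
    let N := upProd (crossingData h2 ω i j ρ hj hij).U (allRows p) +
      downProd (crossingData h2 ω i j ρ hj hij).D (allRows p)
    N.1 1 0 = 0 ∧ N.1 2 1 = 0 ∧ N.1 2 0 = ω i ρ * ∏ h ∈ Finset.univ.erase ρ, ω j h ∧
      N.1 3 1 = ω i ρ * ∏ h ∈ Finset.univ.erase ρ, ω j h := by
  intro N
  have hnd := nodup_allRows p
  rw [allRows_eq p ρ, List.nodup_append', List.nodup_cons] at hnd
  have h1 : ρ ∉ rows p ρ := fun h => hnd.2.2 h (by simp)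
  have h3 : ρ ∉ rows (ρ + 1) p := hnd.2.1.1
  have hpr : ∀ f : Fin n → R, ∏ h ∈ Finset.univ.erase ρ, f h =
      ((rows p ρ).map f).prod * ((rows (ρ + 1) p).map f).prod := by
    intro f
    rw [← List.prod_append, ← List.map_append, ← List.prod_toFinset]
    · congr 1
      ext k
      have hk : k ∈ allRows p := mem_allRows p k
      rw [allRows_eq p ρ] at hk
      simp only [List.mem_append, List.mem_cons] at hk
      simp only [Finset.mem_erase, Finset.mem_univ, and_true, List.mem_toFinset, List.mem_append]
      constructor
      · tauto
      · rintro (h | h) rfl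
        · exact h1 h
        · exact h3 h
    · rw [List.nodup_append']
      exact ⟨hnd.1, hnd.2.1.2, fun k hk hk' => hnd.2.2 hk (List.mem_cons_of_mem _ hk')⟩
  have hN : N = zigzag.ofDiag ((rows (ρ + 1) p).map (ω j)).prod ((rows (ρ + 1) p).map (ω i)).prod *
      zigzag.upStep (ω j ρ) (ω i ρ) *
      zigzag.ofDiag ((rows p ρ).map (ω j)).prod ((rows p ρ).map (ω i)).prod +
      zigzag.ofDiag ((rows p ρ).map (ω i)).prod ((rows p ρ).map (ω j)).prod *
      zigzag.downStep (ω i ρ) (ω j ρ) *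
      zigzag.ofDiag ((rows (ρ + 1) p).map (ω i)).prod ((rows (ρ + 1) p).map (ω j)).prod := by
    simp only [N]
    rw [allRows_eq p ρ, upProd_append, upProd_cons, upProd_of_notMem h2 ω i j ρ hj hij _ h1,
      upProd_of_notMem h2 ω i j ρ hj hij _ h3, downProd_append, downProd_cons,
      downProd_of_notMem h2 ω i j ρ hj hij _ h1, downProd_of_notMem h2 ω i j ρ hj hij _ h3,
      mul_assoc (zigzag.ofDiag _ _) (zigzag.downStep _ _)]
    simp [crossingData]
  rw [hN]
  simp only [Subalgebra.coe_add, Matrix.add_apply, zigzag.ofDiag_mul_mul, hpr]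
  refine ⟨?_, ?_, ?_, ?_⟩
  · refine Eq.trans ?_
      (h2 (((rows (ρ + 1) p).map (ω i)).prod * ω i ρ * ((rows p ρ).map (ω j)).prod))
    simp [zigzag.upStep, zigzag.downStep]
    ring
  · refine Eq.trans ?_
      (h2 (((rows (ρ + 1) p).map (ω j)).prod * ω i ρ * ((rows p ρ).map (ω i)).prod))
    simp [zigzag.upStep, zigzag.downStep]
    ring
  · simp [zigzag.upStep, zigzag.downStep]
    ring
  · simp [zigzag.upStep, zigzag.downStep]
    ring

/-- The weight of a rectangle as a product over its squares. -/
def squareWeight (ω : Fin n → Fin n → R) (a b p q : Fin n) : R :=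
  ∏ c ∈ cyclicIco a b, ∏ h ∈ cyclicIco p q, ω c h

theorem mem_cyclicIco_of_adjacent {i j : Fin n} (hj : j = i + 1) (a b : Fin n) :
    i ∈ cyclicIco a b ↔ a ≠ j ∧ (b = j ∨ j ∈ cyclicIco a b) := by
  have h1 := val_add_one' i
  rw [← hj] at h1
  rw [mem_cyclicIco_iff, mem_cyclicIco_iff]
  have := i.2
  have := a.2
  have := b.2
  have := j.2
  simp only [Fin.ext_iff, Fin.lt_def, Fin.le_def, ne_eq] at *
  split_ifs at h1 <;> omega

omit [NeZero n] in
/-- The columns of a rectangle with western side `a` and eastern side `b`, sorted into those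
different from two adjacent columns `i`, `j` and the possible occurrences of these. -/
@[to_additive]
theorem prod_arc_split {M : Type*} [CommMonoid M] {i j : Fin n} (hij : i ≠ j) {a b : Fin n}
    (hi : i ∈ cyclicIco a b ↔ a ≠ j ∧ (b = j ∨ j ∈ cyclicIco a b)) (hab : a ≠ b)
    (f : Fin n → M) :
    ∏ c ∈ cyclicIco a b, f c = (∏ c ∈ (cyclicIco a b).filter fun c => c ≠ i ∧ c ≠ j, f c) *
      (if a = j then f j else if b = j then f i else
        if j ∈ cyclicIco a b then f i * f j else 1) := by
  have hf : ((cyclicIco a b).filter fun c => ¬ (c ≠ i ∧ c ≠ j)) =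
      ({i, j} : Finset (Fin n)).filter fun c => c ∈ cyclicIco a b := by
    ext c
    simp only [Finset.mem_filter, Finset.mem_insert, Finset.mem_singleton]
    tauto
  have ha : a = j → j ∈ cyclicIco a b := fun h => by
    rw [mem_cyclicIco_iff_cyc hab]; exact Or.inl h.symm
  have hb : b = j → j ∉ cyclicIco a b := fun h => by
    rw [mem_cyclicIco_iff]; omega
  rw [← Finset.prod_filter_mul_prod_filter_not _ fun c => c ≠ i ∧ c ≠ j, hf]
  congr 1
  rw [Finset.prod_filter, Finset.prod_pair hij]
  by_cases h1 : a = j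
  · rw [if_neg fun h => (hi.1 h).1 h1, if_pos (ha h1), if_pos h1, one_mul]
  by_cases h2 : b = j
  · rw [if_pos (hi.2 ⟨h1, Or.inl h2⟩), if_neg (hb h2), if_neg h1, if_pos h2, mul_one]
  by_cases h3 : j ∈ cyclicIco a b <;> simp [hi, h1, h2, h3]

theorem diag₀_U (h : Fin n) : zigzag.diag₀ ((crossingData h2 ω i j ρ hj hij).U h) = ω j h := by
  by_cases hh : h = ρ
  · subst hh; simp only [crossingData, if_true]; rfl
  · simp only [crossingData, if_neg hh]; rfl

theorem diag₀_D (h : Fin n) : zigzag.diag₀ ((crossingData h2 ω i j ρ hj hij).D h) = ω i h := by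
  by_cases hh : h = ρ
  · subst hh; simp only [crossingData, if_true]; rfl
  · simp only [crossingData, if_neg hh]; rfl

theorem diag₁_U (h : Fin n) : zigzag.diag₁ ((crossingData h2 ω i j ρ hj hij).U h) = ω i h := by
  by_cases hh : h = ρ
  · subst hh; simp only [crossingData, if_true]; rfl
  · simp only [crossingData, if_neg hh]; rfl

theorem diag₁_D (h : Fin n) : zigzag.diag₁ ((crossingData h2 ω i j ρ hj hij).D h) = ω j h := by
  by_cases hh : h = ρ
  · subst hh; simp only [crossingData, if_true]; rfl
  · simp only [crossingData, if_neg hh]; rfl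

theorem map_upProd {A B : Type*} [Ring A] [CommRing B] (φ : A →+* B) (U : Fin n → A)
    (p q : Fin n) : φ (upProd U (rows p q)) = ∏ h ∈ cyclicIco p q, φ (U h) := by
  rw [upProd, map_list_prod, List.map_map, List.map_reverse, List.prod_reverse, prod_rows]
  rfl

theorem map_downProd {A B : Type*} [Ring A] [CommRing B] (φ : A →+* B) (D : Fin n → A)
    (p q : Fin n) : φ (downProd D (rows p q)) = ∏ h ∈ cyclicIco p q, φ (D h) := by
  rw [downProd, map_list_prod, List.map_map, prod_rows]
  rfl

/-- An algebra homomorphism to the commutative ring of scalars which turns the holonomy into the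
weights of the columns `i` and `j`, or into those of the interchanged columns, turns the weights
of rectangles into products over squares. -/
theorem map_weight {A : Type*} [Ring A] [Algebra R A] (H : HolonomyData n R A)
    (φ : A →ₐ[R] R) (ω' : Fin n → Fin n → R) (hω : ∀ c, c ≠ H.i → c ≠ H.j → ω' c = H.ω c)
    (hU : ∀ h, φ (H.U h) = ω' H.j h) (hD : ∀ h, φ (H.D h) = ω' H.i h)
    {a b : Fin n} (hab : a ≠ b) (p q : Fin n) :
    φ (H.weight a b p q) = squareWeight ω' a b p q := by
  have hT : ∀ h, H.ω H.i h * H.ω H.j h = ω' H.i h * ω' H.j h := by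
    intro h
    rw [← hU, ← hD, ← map_mul, H.D_mul_U, AlgHom.commutes]
    rfl
  rw [squareWeight, prod_arc_split H.i_ne_j (mem_cyclicIco_of_adjacent H.j_eq a b) hab,
    HolonomyData.weight, map_smul, smul_eq_mul]
  congr 1
  · refine Finset.prod_congr rfl fun c hc => ?_
    rw [prod_rows, hω c (Finset.mem_filter.1 hc).2.1 (Finset.mem_filter.1 hc).2.2]
  rw [HolonomyData.sidePart]
  have h1 := map_upProd (φ : A →+* R) H.U p q
  have h2 := map_downProd (φ : A →+* R) H.D p q
  simp only [RingHom.coe_coe, hU, hD] at h1 h2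
  split_ifs
  · exact h1
  · exact h2
  · rw [AlgHom.commutes, prod_rows, ← Finset.prod_mul_distrib]
    exact (Algebra.algebraMap_self_apply _).trans (Finset.prod_congr rfl fun h _ => hT h)
  · exact map_one φ

theorem diag₀_weight {a b : Fin n} (hab : a ≠ b) (p q : Fin n) :
    zigzag.diag₀ ((crossingData h2 ω i j ρ hj hij).weight a b p q) = squareWeight ω a b p q :=
  map_weight (crossingData h2 ω i j ρ hj hij) zigzag.diag₀ ω (fun _ _ _ => rfl)
    (diag₀_U h2 ω i j ρ hj hij) (diag₀_D h2 ω i j ρ hj hij) hab p q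

theorem diag₁_weight {a b : Fin n} (hab : a ≠ b) (p q : Fin n) :
    zigzag.diag₁ ((crossingData h2 ω i j ρ hj hij).weight a b p q) =
      squareWeight (fun c => ω (Equiv.swap i j c)) a b p q :=
  map_weight (crossingData h2 ω i j ρ hj hij) zigzag.diag₁ (fun c => ω (Equiv.swap i j c))
    (fun c h h' => congrArg ω (Equiv.swap_apply_of_ne_of_ne h h'))
    (fun h => by rw [diag₁_U h2 ω i j ρ hj hij]; simp [crossingData])
    (fun h => by rw [diag₁_D h2 ω i j ρ hj hij]; simp [crossingData]) hab p q

end Crossing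

/-! ### Chain maps and homotopies -/

section ChainMaps

variable {n : ℕ} [NeZero n] {R : Type*} [CommRing R]

/-- The matrix of the entries `(k, l)` of the weighted rectangles of a cross-commutation. -/
noncomputable def crossingMatrix (h2 : ∀ y : R, y + y = 0) (ω : Fin n → Fin n → R) (i j ρ : Fin n)
    (hj : j = i + 1) (hij : i ≠ j) (k l : Fin 4) : Matrix (GridState n) (GridState n) R :=
  (rectMatrix (crossingData h2 ω i j ρ hj hij).weight).map (zigzag.entry k l)

variable (h2 : ∀ y : R, y + y = 0) (ω : Fin n → Fin n → R) (i j ρ : Fin n)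
    (hj : j = i + 1) (hij : i ≠ j)

theorem crossingMatrix_zero : crossingMatrix h2 ω i j ρ hj hij 0 0 =
    rectMatrix (squareWeight ω) := by
  classical
  ext y x
  simp only [crossingMatrix, Matrix.map_apply, rectMatrix, map_sum]
  refine Finset.sum_congr rfl fun a _ => Finset.sum_congr rfl fun b _ => ?_
  rw [apply_ite (zigzag.entry (R := R) 0 0), map_zero]
  by_cases h : a ≠ b ∧ y = x * Equiv.swap a b ∧ IsEmptyRect x a b
  · rw [if_pos h, if_pos h]
    exact diag₀_weight h2 ω i j ρ hj hij h.1 _ _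
  · rw [if_neg h, if_neg h]

theorem crossingMatrix_one : crossingMatrix h2 ω i j ρ hj hij 1 1 =
    rectMatrix (squareWeight fun c => ω (Equiv.swap i j c)) := by
  classical
  ext y x
  simp only [crossingMatrix, Matrix.map_apply, rectMatrix, map_sum]
  refine Finset.sum_congr rfl fun a _ => Finset.sum_congr rfl fun b _ => ?_
  rw [apply_ite (zigzag.entry (R := R) 1 1), map_zero]
  by_cases h : a ≠ b ∧ y = x * Equiv.swap a b ∧ IsEmptyRect x a b
  · rw [if_pos h, if_pos h]
    exact diag₁_weight h2 ω i j ρ hj hij h.1 _ _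
  · rw [if_neg h, if_neg h]

/-- The four relations contained in the square of the matrix of weighted rectangles: chain maps
in both directions, and homotopies of their composites to multiplication by a scalar. -/
theorem crossingMatrix_relations (κ : R)
    (hcol : ∀ c, ∏ h, ω c h = κ) (hrow : ∀ h, ∏ c, ω c h = κ) (hρ : ω i ρ = 1) :
    let D := crossingMatrix h2 ω i j ρ hj hij
    D 1 0 * D 0 0 + D 1 1 * D 1 0 = 0 ∧ D 2 1 * D 1 1 + D 0 0 * D 2 1 = 0 ∧
    D 2 0 * D 0 0 + D 2 1 * D 1 0 + D 0 0 * D 2 0 =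
      Matrix.scalar _ (∏ h ∈ Finset.univ.erase ρ, ω j h) ∧
    D 3 1 * D 1 1 + D 1 0 * D 2 1 + D 1 1 * D 3 1 =
      Matrix.scalar _ (∏ h ∈ Finset.univ.erase ρ, ω j h) := by
  intro D
  set H := crossingData h2 ω i j ρ hj hij
  have hA : ∀ y : zigzag R, y + y = 0 := fun y => Subtype.ext (by ext k l; exact h2 _)
  have hsq := H.rectMatrix_sq hA κ hcol hrow
  have hent : ∀ k l z x, zigzag.entry k l ((rectMatrix H.weight * rectMatrix H.weight) z x) =
      ∑ y, (rectMatrix H.weight z y * rectMatrix H.weight y x).1 k l := by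
    intro k l z x
    rw [Matrix.mul_apply, map_sum]
    rfl
  have hann := fun x : GridState n => annuli_entries h2 ω i j ρ hj hij (x j)
  simp only [hρ, one_mul] at hann
  have hval : ∀ k l z x, (∑ y, (rectMatrix H.weight z y * rectMatrix H.weight y x).1 k l) =
      if z = x then (upProd H.U (allRows (x j)) + downProd H.D (allRows (x j))).1 k l else 0 := by
    intro k l z x
    rw [← hent, hsq, apply_ite (zigzag.entry (R := R) k l), map_zero]
    rfl
  refine ⟨?_, ?_, ?_, ?_⟩
  · ext z x
    rw [Matrix.add_apply, Matrix.mul_apply, Matrix.mul_apply, ← Finset.sum_add_distrib]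
    refine Eq.trans (Finset.sum_congr rfl fun y _ => ?_) ((hval 1 0 z x).trans ?_)
    · exact (zigzag.entries_mul _ _).2.2.1.symm
    · rw [(hann x).1]; simp
  · ext z x
    rw [Matrix.add_apply, Matrix.mul_apply, Matrix.mul_apply, ← Finset.sum_add_distrib]
    refine Eq.trans (Finset.sum_congr rfl fun y _ => ?_) ((hval 2 1 z x).trans ?_)
    · exact (zigzag.entries_mul _ _).2.2.2.1.symm
    · rw [(hann x).2.1]; simp
  · ext z x
    rw [Matrix.add_apply, Matrix.add_apply, Matrix.mul_apply, Matrix.mul_apply, Matrix.mul_apply,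
      ← Finset.sum_add_distrib, ← Finset.sum_add_distrib]
    refine Eq.trans (Finset.sum_congr rfl fun y _ => ?_) ((hval 2 0 z x).trans ?_)
    · exact (zigzag.entries_mul _ _).2.2.2.2.1.symm
    · rw [(hann x).2.2.1, Matrix.scalar_apply, Matrix.diagonal_apply]
  · ext z x
    rw [Matrix.add_apply, Matrix.add_apply, Matrix.mul_apply, Matrix.mul_apply, Matrix.mul_apply,
      ← Finset.sum_add_distrib, ← Finset.sum_add_distrib]
    refine Eq.trans (Finset.sum_congr rfl fun y _ => ?_) ((hval 3 1 z x).trans ?_)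
    · exact (zigzag.entries_mul _ _).2.2.2.2.2.symm
    · rw [(hann x).2.2.2, Matrix.scalar_apply, Matrix.diagonal_apply]

end ChainMaps

end Zigzag

section Maslov

/-! ### The Maslov function -/

variable {n : ℕ}

/-- The indicator of `b ≤ a`. -/
def geInd (a b : Fin n) : ℝ := if b ≤ a then 1 else 0

theorem geInd_self (a : Fin n) : geInd a a = 1 := if_pos le_rfl

theorem geInd_add_geInd {a b : Fin n} (h : a ≠ b) : geInd a b + geInd b a = 1 := by
  unfold geInd
  rcases lt_or_gt_of_ne h with h | h
  · rw [if_neg (not_le.2 h), if_pos h.le, zero_add]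
  · rw [if_neg (not_le.2 h), if_pos h.le, add_zero]

theorem geInd_eq (a b : Fin n) : geInd a b = 1 - geInd b a + if a = b then 1 else 0 := by
  by_cases h : a = b
  · subst h; simp [geInd_self]
  · rw [if_neg h, ← geInd_add_geInd h]; ring

/-- The number of points of the graph of `P` that lie weakly to the north-east of `(i, h)`. -/
def countGe (P : Equiv.Perm (Fin n)) (i h : Fin n) : ℝ := ∑ c, geInd c i * geInd (P c) h

/-- The signed number of points of the graph of `P` in the planar rectangle with sides
`a, b, p, q`. -/
def signedCount (P : Equiv.Perm (Fin n)) (a b p q : Fin n) : ℝ :=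
  ∑ c, (geInd c a - geInd c b) * (geInd (P c) p - geInd (P c) q)

theorem signedCount_eq (P : Equiv.Perm (Fin n)) (a b p q : Fin n) :
    signedCount P a b p q = countGe P a p + countGe P b q - countGe P a q - countGe P b p := by
  simp only [signedCount, countGe, ← Finset.sum_add_distrib, ← Finset.sum_sub_distrib]
  exact Finset.sum_congr rfl fun c _ => by ring

/-- The number of pairs of points of the graph of `x` that are in increasing position. -/
def pairCount (x : Equiv.Perm (Fin n)) : ℝ := ∑ i, (countGe x i (x i) - 1)

/-- The effect of a transposition on a sum over the points of a graph. -/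
theorem sum_swap_sub {a b : Fin n} (hab : a ≠ b) (F : Fin n → Fin n → ℝ)
    (x : Equiv.Perm (Fin n)) :
    ∑ i, F i ((x * Equiv.swap a b) i) =
      ∑ i, F i (x i) + (F a (x b) + F b (x a) - F a (x a) - F b (x b)) := by
  rw [← sub_eq_iff_eq_add', ← Finset.sum_sub_distrib]
  rw [← Finset.sum_subset (Finset.subset_univ {a, b})]
  · rw [Finset.sum_pair hab, mul_swap_left, mul_swap_right]; ring
  · intro c _ hc
    simp only [Finset.mem_insert, Finset.mem_singleton, not_or] at hc
    rw [mul_swap_of_ne x hc.1 hc.2, sub_self]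

theorem countGe_swap {a b : Fin n} (hab : a ≠ b) (P : Equiv.Perm (Fin n)) (i h : Fin n) :
    countGe (P * Equiv.swap a b) i h =
      countGe P i h + (geInd a i - geInd b i) * (geInd (P b) h - geInd (P a) h) := by
  unfold countGe
  rw [sum_swap_sub hab fun c k => geInd c i * geInd k h]
  ring

theorem pairCount_swap {a b : Fin n} (hab : a ≠ b) (x : Equiv.Perm (Fin n)) :
    pairCount (x * Equiv.swap a b) =
      pairCount x + 1 - 2 * signedCount x a b (x a) (x b) := by
  set F : Fin n → Fin n → ℝ := fun i k =>
    (geInd a i - geInd b i) * (geInd (x b) k - geInd (x a) k) with hF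
  have h1 : ∑ i, F i (x i) = - signedCount x a b (x a) (x b) := by
    rw [signedCount, ← Finset.sum_neg_distrib, ← sub_eq_zero, ← Finset.sum_sub_distrib,
      ← Finset.sum_subset (Finset.subset_univ {a, b})]
    · rw [Finset.sum_pair hab]
      simp only [hF, geInd_self]
      have e1 := geInd_add_geInd hab
      have e2 := geInd_add_geInd (x.injective.ne hab)
      have : geInd b a = 1 - geInd a b := by linarith
      rw [this]
      have : geInd (x b) (x a) = 1 - geInd (x a) (x b) := by linarith
      rw [this]
      ring
    · intro c _ hc
      simp only [Finset.mem_insert, Finset.mem_singleton, not_or] at hc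
      have e1 := geInd_add_geInd hc.1
      have e2 := geInd_add_geInd hc.2
      have e3 := geInd_add_geInd (x.injective.ne hc.1)
      have e4 := geInd_add_geInd (x.injective.ne hc.2)
      simp only [hF]
      rw [show geInd a c = 1 - geInd c a by linarith, show geInd b c = 1 - geInd c b by linarith,
        show geInd (x a) (x c) = 1 - geInd (x c) (x a) by linarith,
        show geInd (x b) (x c) = 1 - geInd (x c) (x b) by linarith]
      ring
  have h2 : ∑ i, F i ((x * Equiv.swap a b) i) = 1 - signedCount x a b (x a) (x b) := by
    rw [sum_swap_sub hab, h1]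
    simp only [hF, geInd_self]
    have e1 := geInd_add_geInd hab
    have e2 := geInd_add_geInd (x.injective.ne hab)
    rw [show geInd b a = 1 - geInd a b by linarith,
      show geInd (x b) (x a) = 1 - geInd (x a) (x b) by linarith]
    ring
  simp only [pairCount, countGe_swap hab, Finset.sum_sub_distrib, Finset.sum_add_distrib]
  rw [h2, sum_swap_sub hab fun i k => countGe x i k]
  rw [signedCount_eq]
  ring

theorem countNE_image {f g : Fin n → ℕ × ℕ} (hf : f.Injective) (hg : g.Injective) :
    (countNE (Finset.univ.image f) (Finset.univ.image g) : ℝ) =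
      ∑ i, ∑ k, if (f i).1 < (g k).1 ∧ (f i).2 < (g k).2 then 1 else 0 := by
  rw [countNE, Finset.card_filter, Finset.sum_product, Finset.sum_image hf.injOn]
  push_cast
  refine Finset.sum_congr rfl fun i _ => ?_
  rw [Finset.sum_image hg.injOn]

theorem statePoints_injective (x : GridState n) :
    Function.Injective fun i : Fin n => (2 * (i : ℕ), 2 * (x i : ℕ)) := by
  intro i k h
  simp only [Prod.mk.injEq] at h
  exact Fin.ext (by omega)

theorem markingPoints_injective (P : Equiv.Perm (Fin n)) :
    Function.Injective fun c : Fin n => (2 * (c : ℕ) + 1, 2 * (P c : ℕ) + 1) := by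
  intro i k h
  simp only [Prod.mk.injEq] at h
  exact Fin.ext (by omega)

theorem sum_pairs_lt (x : Equiv.Perm (Fin n)) :
    (∑ i, ∑ k, if i < k ∧ x i < x k then (1 : ℝ) else 0) = pairCount x := by
  refine Finset.sum_congr rfl fun i _ => ?_
  rw [countGe, ← Finset.add_sum_erase _ _ (Finset.mem_univ i),
    ← Finset.add_sum_erase _ _ (Finset.mem_univ i),
    geInd_self, geInd_self]
  simp only [lt_irrefl, false_and, if_false, zero_add, mul_one, add_sub_cancel_left]
  refine Finset.sum_congr rfl fun k hk => ?_
  have hk := Finset.ne_of_mem_erase hk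
  have hk' := x.injective.ne hk
  simp only [geInd, lt_iff_le_and_ne, hk.symm, hk'.symm, ne_eq, not_false_eq_true, and_true]
  split_ifs <;> simp_all

theorem sum_countGe_compl (P : Equiv.Perm (Fin n)) (i h : Fin n) :
    (∑ c, if c < i ∧ P c < h then (1 : ℝ) else 0) =
      countGe P i h + ((i : ℕ) : ℝ) + ((h : ℕ) : ℝ) - n := by
  have key : ∀ c, (if c < i ∧ P c < h then (1 : ℝ) else 0) =
      geInd c i * geInd (P c) h + (if c < i then 1 else 0) + (if P c < h then 1 else 0) - 1 := by
    intro c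
    simp only [geInd, ← not_lt]
    by_cases h1 : c < i <;> by_cases h2 : P c < h <;> simp [h1, h2]
  simp only [key, Finset.sum_sub_distrib, Finset.sum_add_distrib]
  have hsum : ∀ k : Fin n, (∑ c : Fin n, if c < k then (1 : ℝ) else 0) = ((k : ℕ) : ℝ) := by
    intro k
    rw [Finset.sum_boole]
    congr 1
    rw [show (Finset.univ.filter fun c : Fin n => c < k) = Finset.Iio k by ext; simp, Fin.card_Iio]
  rw [hsum, Equiv.sum_comp P fun c => if c < h then (1 : ℝ) else 0, hsum]
  simp [countGe]

/-- The Maslov function, up to a constant that depends only on `n`. -/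
theorem maslovWith_eq (P : Equiv.Perm (Fin n)) (x : GridState n) :
    maslovWith P x = pairCount x - 2 * ∑ i, countGe P i (x i) + pairCount P +
      (1 - ∑ i : Fin n, (2 * ((i : ℕ) : ℝ) - n)) := by
  have h1 : (countNE (statePoints x) (statePoints x) : ℝ) = pairCount x := by
    rw [statePoints, countNE_image (statePoints_injective x) (statePoints_injective x),
      ← sum_pairs_lt]
    simp
  have h2 : (countNE (markingPoints P) (markingPoints P) : ℝ) = pairCount P := by
    rw [markingPoints, countNE_image (markingPoints_injective P) (markingPoints_injective P),
      ← sum_pairs_lt]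
    simp
  have h3 : (countNE (statePoints x) (markingPoints P) : ℝ) = ∑ i, countGe P i (x i) := by
    rw [statePoints, markingPoints,
      countNE_image (statePoints_injective x) (markingPoints_injective P)]
    refine Finset.sum_congr rfl fun i _ => Finset.sum_congr rfl fun c _ => ?_
    simp only [geInd, Fin.le_def]
    split_ifs <;> first | (simp; done) | (exfalso; omega)
  have h4 : (countNE (markingPoints P) (statePoints x) : ℝ) =
      ∑ i, countGe P i (x i) + ∑ i : Fin n, (2 * ((i : ℕ) : ℝ) - n) := by
    rw [statePoints, markingPoints,
      countNE_image (markingPoints_injective P) (statePoints_injective x), Finset.sum_comm]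
    have : ∀ i c : Fin n, (2 * (c : ℕ) + 1 < 2 * (i : ℕ) ∧ 2 * (P c : ℕ) + 1 < 2 * (x i : ℕ)) ↔
        c < i ∧ P c < x i := by
      intro i c; simp only [Fin.lt_def]; omega
    simp only [this, sum_countGe_compl, Finset.sum_sub_distrib, Finset.sum_add_distrib]
    rw [Equiv.sum_comp x fun i => ((i : ℕ) : ℝ), ← Finset.mul_sum]
    ring
  rw [maslovWith, countSymm, countSymm, countSymm, h1, h2, h3, h4]
  ring

/-- The indicator of a cyclic interval. -/
theorem indicator_cyclicIco (a b c : Fin n) :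
    (if c ∈ cyclicIco a b then (1 : ℝ) else 0) =
      geInd c a - geInd c b + (1 - geInd b a) := by
  simp only [mem_cyclicIco_iff, geInd]
  split_ifs <;> first | (norm_num; done) | (exfalso; omega)

/-- The number of points of the graph of `P` in a rectangle of the torus. -/
def rectCount (P : Equiv.Perm (Fin n)) (a b p q : Fin n) : ℝ :=
  ∑ c, if c ∈ cyclicIco a b ∧ P c ∈ cyclicIco p q then 1 else 0

/-- The difference between toroidal and planar counts does not depend on the permutation. -/
theorem rectCount_sub (P Q : Equiv.Perm (Fin n)) (a b p q : Fin n) :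
    rectCount P a b p q - signedCount P a b p q = rectCount Q a b p q - signedCount Q a b p q := by
  have key : ∀ P : Equiv.Perm (Fin n), rectCount P a b p q - signedCount P a b p q =
      (1 - geInd q p) * ∑ c, (geInd c a - geInd c b) +
      (1 - geInd b a) * ∑ c, (geInd c p - geInd c q) + n * ((1 - geInd b a) * (1 - geInd q p)) := by
    intro P
    have : ∀ c, (if c ∈ cyclicIco a b ∧ P c ∈ cyclicIco p q then (1 : ℝ) else 0) =
        (geInd c a - geInd c b) * (geInd (P c) p - geInd (P c) q) +
        (1 - geInd q p) * (geInd c a - geInd c b) +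
        (1 - geInd b a) * (geInd (P c) p - geInd (P c) q) +
        (1 - geInd b a) * (1 - geInd q p) := by
      intro c
      have h1 := ite_zero_mul_ite_zero (P := c ∈ cyclicIco a b) (Q := P c ∈ cyclicIco p q) (1 : ℝ) 1
      rw [mul_one, indicator_cyclicIco, indicator_cyclicIco] at h1
      rw [← h1]
      ring
    rw [rectCount, signedCount]
    simp only [this, Finset.sum_add_distrib, ← Finset.mul_sum]
    rw [Equiv.sum_comp P fun c => geInd c p - geInd c q]
    simp
    ring
  rw [key, key]

theorem rectCount_state {x : GridState n} {a b : Fin n} (hab : a ≠ b) (h : IsEmptyRect x a b) :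
    rectCount x a b (x a) (x b) = 1 := by
  rw [rectCount, Finset.sum_eq_single a]
  · rw [if_pos]
    rw [mem_cyclicIco_iff_cyc hab, mem_cyclicIco_iff_cyc (x.injective.ne hab)]
    simp
  · intro c _ hc
    rw [if_neg]
    rw [mem_cyclicIco_iff_cyc hab, mem_cyclicIco_iff_cyc (x.injective.ne hab)]
    rintro ⟨h1 | h1, h2 | h2⟩
    · exact hc h1
    · exact hc h1
    · exact hc (x.injective h2)
    · exact h c ⟨h1, h2⟩
  · simp

/-- The change of the Maslov function along an empty rectangle. -/
theorem maslovWith_sub (P : Equiv.Perm (Fin n)) {x : GridState n} {a b : Fin n} (hab : a ≠ b)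
    (h : IsEmptyRect x a b) :
    maslovWith P x - maslovWith P (x * Equiv.swap a b) = 1 - 2 * rectCount P a b (x a) (x b) := by
  have h1 := rectCount_sub P x a b (x a) (x b)
  rw [rectCount_state hab h] at h1
  rw [maslovWith_eq, maslovWith_eq, pairCount_swap hab, sum_swap_sub hab fun i k => countGe P i k]
  have h2 := signedCount_eq P a b (x a) (x b)
  linarith

section Adjacent

variable [NeZero n]

/-- The change of the Maslov function when the columns `i` and `i + 1` are interchanged, where `u`
and `v` are the heights of their markings and `h` is the height of the point of the state on the
circle between them. -/
def swapShift (u v h : Fin n) : ℝ := 2 * geInd u v - 1 + 2 * (geInd v h - geInd u h)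

theorem geInd_sub_geInd_add_one {i j : Fin n} (hj : j = i + 1) (hij : i ≠ j) (k : Fin n) :
    geInd k i - geInd k j = (if k = i then 1 else 0) - (1 - geInd j i) ∧
      geInd i k - geInd j k = (1 - geInd j i) - (if k = j then 1 else 0) := by
  have h1 := val_add_one' i
  rw [← hj] at h1
  have := i.2
  have := k.2
  have := j.2
  simp only [geInd, Fin.ext_iff, Fin.le_def, ne_eq] at *
  split_ifs at h1 <;> constructor <;> split_ifs <;> first | (norm_num; done) | (exfalso; omega)

theorem maslovWith_mul_swap (P : Equiv.Perm (Fin n)) (x : GridState n) {i j : Fin n}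
    (hj : j = i + 1) (hij : i ≠ j) :
    maslovWith (P * Equiv.swap i j) x = maslovWith P x + swapShift (P i) (P j) (x j) := by
  have e1 := fun k => (geInd_sub_geInd_add_one hj hij k).1
  have e2 := fun k => (geInd_sub_geInd_add_one hj hij k).2
  rw [maslovWith_eq, maslovWith_eq, pairCount_swap hij]
  simp only [countGe_swap hij, Finset.sum_add_distrib, signedCount, e1, e2, sub_mul,
    Finset.sum_sub_distrib, ite_mul, one_mul, zero_mul, Finset.sum_ite_eq', Finset.mem_univ,
    if_true, ← Finset.mul_sum, geInd_self, swapShift]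
  have h1 : ∑ c, (geInd (P c) (P i) - geInd (P c) (P j)) =
      ∑ k, (geInd (P j) (x k) - geInd (P i) (x k)) := by
    rw [Equiv.sum_comp P fun c => geInd c (P i) - geInd c (P j),
      Equiv.sum_comp x fun c => geInd (P j) c - geInd (P i) c]
    simp only [fun c => geInd_eq c (P i), fun c => geInd_eq c (P j), Finset.sum_sub_distrib,
      Finset.sum_add_distrib, Finset.sum_ite_eq', Finset.mem_univ, if_true]
    ring
  simp only [Finset.sum_sub_distrib] at h1 ⊢
  linear_combination (2 * (1 - geInd j i)) * h1

theorem swapShift_add_one (u v h : Fin n) :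
    swapShift u v (h + 1) - swapShift u v h =
      2 * ((if u = h then 1 else 0) - if v = h then 1 else 0) := by
  have h1 := val_add_one' h
  have := u.2
  have := v.2
  have := h.2
  simp only [swapShift, geInd, Fin.ext_iff, Fin.le_def] at *
  split_ifs at h1 <;> rw [h1] <;> split_ifs <;> first | (norm_num; done) | (exfalso; omega)

end Adjacent

/-! ### The Maslov function of a reflected state -/

theorem countNE_swap (P Q : Finset (ℕ × ℕ)) :
    countNE (P.image Prod.swap) (Q.image Prod.swap) = countNE P Q := by
  refine Finset.card_bij (fun pq _ => (pq.1.swap, pq.2.swap)) ?_ ?_ ?_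
  · rintro ⟨p, q⟩ h
    simp only [Finset.mem_filter, Finset.mem_product, Finset.mem_image] at h ⊢
    obtain ⟨⟨⟨p', hp, rfl⟩, q', hq, rfl⟩, h1, h2⟩ := h
    exact ⟨⟨hp, hq⟩, h2, h1⟩
  · rintro ⟨p, q⟩ _ ⟨p', q'⟩ _ h
    simpa using h
  · rintro ⟨p, q⟩ h
    simp only [Finset.mem_filter, Finset.mem_product] at h
    refine ⟨(p.swap, q.swap), ?_, by simp⟩
    simp only [Finset.mem_filter, Finset.mem_product]
    exact ⟨⟨Finset.mem_image_of_mem _ h.1.1, Finset.mem_image_of_mem _ h.1.2⟩, h.2.2, h.2.1⟩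

theorem maslovWith_inv (P : Equiv.Perm (Fin n)) (x : GridState n) :
    maslovWith P⁻¹ x⁻¹ = maslovWith P x := by
  have hs : statePoints x⁻¹ = (statePoints x).image Prod.swap := by
    ext p
    simp only [statePoints, Finset.mem_image, Finset.mem_univ, true_and, exists_exists_eq_and]
    constructor
    · rintro ⟨i, rfl⟩
      exact ⟨x⁻¹ i, by simp⟩
    · rintro ⟨i, rfl⟩
      exact ⟨x i, by simp⟩
  have hm : markingPoints P⁻¹ = (markingPoints P).image Prod.swap := by
    ext p
    simp only [markingPoints, Finset.mem_image, Finset.mem_univ, true_and, exists_exists_eq_and]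
    constructor
    · rintro ⟨i, rfl⟩
      exact ⟨P⁻¹ i, by simp⟩
    · rintro ⟨i, rfl⟩
      exact ⟨P i, by simp⟩
  simp only [maslovWith, countSymm, hs, hm, countNE_swap]

end Maslov

section Homogeneity

/-! ### Homogeneous elements -/

variable {t : ℝ≥0}

theorem TRing.add_self (y : TRing t) : y + y = 0 := by
  rw [← two_smul (ZMod 2) y, show (2 : ZMod 2) = 0 from rfl, zero_smul]

/-- The inclusion of `ℛ_t` into the ring of long power series. -/
noncomputable def TRing.toSeries (t : ℝ≥0) : TRing t →+* LongPowerSeries :=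
  (tSubring t).val.toRingHom

/-- The elements of `ℛ_t` that are multiples of `U ^ α`, for a real number `α`. -/
def IsMono (α : ℝ) (z : TRing t) : Prop :=
  ∀ e : ℝ≥0, (TRing.toSeries t z).coeff e ≠ 0 → (e : ℝ) = α

theorem IsMono.of_eq {α β : ℝ} {z : TRing t} (hz : IsMono α z) (h : α = β) : IsMono β z := h ▸ hz

theorem IsMono.zero (α : ℝ) : IsMono α (0 : TRing t) := by
  intro e he
  rw [map_zero] at he
  exact absurd rfl he

theorem IsMono.add {α : ℝ} {y z : TRing t} (hy : IsMono α y) (hz : IsMono α z) :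
    IsMono α (y + z) := by
  intro e he
  rw [map_add, HahnSeries.coeff_add] at he
  by_contra h
  exact he (by rw [not_not.1 fun h' => h (hy e h'), not_not.1 fun h' => h (hz e h'), add_zero])

theorem IsMono.mul {α β : ℝ} {y z : TRing t} (hy : IsMono α y) (hz : IsMono β z) :
    IsMono (α + β) (y * z) := by
  intro e he
  rw [map_mul] at he
  obtain ⟨a, ha, b, hb, rfl⟩ := HahnSeries.support_mul_subset he
  rw [NNReal.coe_add, hy a ha, hz b hb]

theorem isMono_tMonomial (ht : t ≤ 2) (a b : ℕ) :
    IsMono ((t : ℝ) * a + (2 - t) * b) (tMonomial t a b) := by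
  intro e he
  have : (TRing.toSeries t (tMonomial t a b)).coeff e =
    (HahnSeries.single (t * a + (2 - t) * b : ℝ≥0) (1 : ZMod 2)).coeff e := rfl
  rw [this, HahnSeries.coeff_single] at he
  have he' : e = t * a + (2 - t) * b := by
    by_contra h
    exact he (if_neg h)
  rw [he']
  push_cast [NNReal.coe_sub ht]
  rfl

/-- Over the field with two elements, a nonzero multiple of `U ^ α` is `U ^ α`. -/
theorem IsMono.eq_zero_or {α : ℝ} {z : TRing t} (hz : IsMono α z) :
    z = 0 ∨ ∃ (e : ℝ≥0) (he : Upow e ∈ tSubring t), (e : ℝ) = α ∧ z = (⟨Upow e, he⟩ : TRing t) := by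
  by_cases h : z = 0
  · exact Or.inl h
  right
  have h1 : TRing.toSeries t z ≠ 0 := fun h' => h (Subtype.ext h')
  have : ∃ e, (TRing.toSeries t z).coeff e ≠ 0 := by
    by_contra! h'
    exact h1 (HahnSeries.ext (funext h'))
  obtain ⟨e, he⟩ := this
  have h2 : TRing.toSeries t z = Upow e := by
    ext e'
    rw [Upow, HahnSeries.coeff_single]
    split_ifs with h3
    · subst h3
      generalize (TRing.toSeries t z).coeff e' = c at he
      revert c
      decide
    · by_contra h4
      exact h3 (NNReal.coe_injective ((hz e' h4).trans (hz e he).symm))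
  have h3 : Upow e ∈ tSubring t := h2 ▸ (z : tSubring t).2
  exact ⟨e, h3, hz e he, Subtype.ext h2⟩

theorem isMono_Upow (e : ℝ≥0) (he : Upow e ∈ tSubring t) : IsMono e (⟨Upow e, he⟩ : TRing t) := by
  intro e' he'
  have : (TRing.toSeries t (⟨Upow e, he⟩ : TRing t)).coeff e' =
    (HahnSeries.single e (1 : ZMod 2)).coeff e' := rfl
  rw [this, HahnSeries.coeff_single] at he'
  by_contra h
  exact he' (if_neg fun h' => h (by rw [h']))

theorem tMonomial_mul (a b a' b' : ℕ) :
    tMonomial t a b * tMonomial t a' b' = tMonomial t (a + a') (b + b') := by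
  apply Subtype.ext
  refine (Upow_mul _ _).trans (congrArg Upow ?_)
  push_cast
  ring

theorem tMonomial_zero : tMonomial t 0 0 = 1 := by
  apply Subtype.ext
  show Upow _ = 1
  simp [Upow]

theorem prod_tMonomial {ι : Type*} (s : Finset ι) (f g : ι → ℕ) :
    ∏ i ∈ s, tMonomial t (f i) (g i) = tMonomial t (∑ i ∈ s, f i) (∑ i ∈ s, g i) := by
  classical
  induction s using Finset.induction_on with
  | empty => simp [tMonomial_zero]
  | insert a s ha ih => rw [Finset.prod_insert ha, Finset.sum_insert ha, Finset.sum_insert ha, ih,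
      tMonomial_mul]

/-- Homogeneous elements of weight `α` of the zigzag algebra: the entries are multiples of powers
of `U`, the first diagonal entry has the exponent `α`, and the exponents of the others are shifted
by the potentials `l` at the source and `l'` at the target. The potential of a grid state will be
one plus its grading with respect to the first object minus that with respect to the second. -/
structure IsHom (N : zigzag (TRing t)) (α l l' : ℝ) : Prop where
  e00 : IsMono α (N.1 0 0)
  e11 : IsMono (α + l - l') (N.1 1 1)
  e10 : IsMono (α - l') (N.1 1 0)
  e21 : IsMono (α + l - t) (N.1 2 1)

theorem IsHom.mul {N M : zigzag (TRing t)} {α β k l m : ℝ} (hN : IsHom N α l m)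
    (hM : IsHom M β k l) : IsHom (N * M) (α + β) k m := by
  obtain ⟨h1, h2, h3, h4, -⟩ := zigzag.entries_mul N M
  refine ⟨?_, ?_, ?_, ?_⟩
  · rw [h1]; exact hN.e00.mul hM.e00
  · rw [h2]; exact IsMono.of_eq (hN.e11.mul hM.e11) (by ring)
  · rw [h3]
    refine IsMono.add ?_ ?_
    · exact IsMono.of_eq (hN.e10.mul hM.e00) (by ring)
    · exact IsMono.of_eq (hN.e11.mul hM.e10) (by ring)
  · rw [h4]
    refine IsMono.add ?_ ?_
    · exact IsMono.of_eq (hN.e21.mul hM.e11) (by ring)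
    · exact IsMono.of_eq (hN.e00.mul hM.e21) (by ring)

theorem IsHom.smul {N : zigzag (TRing t)} {α β l m : ℝ} {r : TRing t} (hr : IsMono α r)
    (hN : IsHom N β l m) : IsHom (r • N) (α + β) l m := by
  refine ⟨hr.mul hN.e00, ?_, ?_, ?_⟩
  · exact IsMono.of_eq (hr.mul hN.e11) (by ring)
  · exact IsMono.of_eq (hr.mul hN.e10) (by ring)
  · exact IsMono.of_eq (hr.mul hN.e21) (by ring)

theorem IsMono.one : IsMono 0 (1 : TRing t) := by
  rw [← tMonomial_zero]
  intro e he
  have : (TRing.toSeries t (tMonomial t 0 0)).coeff e =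
    (HahnSeries.single (t * (0 : ℕ) + (2 - t) * (0 : ℕ) : ℝ≥0) (1 : ZMod 2)).coeff e := rfl
  rw [this, HahnSeries.coeff_single] at he
  have he' : e = t * (0 : ℕ) + (2 - t) * (0 : ℕ) := by
    by_contra h
    exact he (if_neg h)
  simp [he']

theorem IsMono.prod {ι : Type*} (s : Finset ι) {f : ι → TRing t} {α : ι → ℝ}
    (h : ∀ i ∈ s, IsMono (α i) (f i)) : IsMono (∑ i ∈ s, α i) (∏ i ∈ s, f i) := by
  classical
  induction s using Finset.induction_on with
  | empty => exact IsMono.one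
  | insert a s ha ih =>
    rw [Finset.sum_insert ha, Finset.prod_insert ha]
    exact (h a (Finset.mem_insert_self a s)).mul (ih fun i hi => h i (Finset.mem_insert_of_mem hi))

theorem isHom_ofDiag {e f : TRing t} {α β l l' : ℝ} (he : IsMono α e) (hf : IsMono β f)
    (h : β = α + l - l') : IsHom (zigzag.ofDiag e f) α l l' :=
  ⟨he, h ▸ hf, IsMono.zero _, IsMono.zero _⟩

theorem isHom_algebraMap {e : TRing t} {α : ℝ} (he : IsMono α e) (l : ℝ) :
    IsHom (algebraMap (TRing t) (zigzag (TRing t)) e) α l l := by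
  rw [← zigzag.ofDiag_self]
  exact isHom_ofDiag he he (by ring)

theorem isHom_one (l : ℝ) : IsHom (1 : zigzag (TRing t)) 0 l l :=
  (map_one (algebraMap (TRing t) (zigzag (TRing t)))) ▸ isHom_algebraMap IsMono.one l

theorem IsHom.zero (α l l' : ℝ) : IsHom (0 : zigzag (TRing t)) α l l' :=
  ⟨IsMono.zero _, IsMono.zero _, IsMono.zero _, IsMono.zero _⟩

theorem IsHom.add {N M : zigzag (TRing t)} {α l l' : ℝ} (hN : IsHom N α l l')
    (hM : IsHom M α l l') : IsHom (N + M) α l l' :=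
  ⟨hN.e00.add hM.e00, hN.e11.add hM.e11, hN.e10.add hM.e10, hN.e21.add hM.e21⟩

theorem IsHom.sum {ι : Type*} (s : Finset ι) {f : ι → zigzag (TRing t)} {α l l' : ℝ}
    (h : ∀ i ∈ s, IsHom (f i) α l l') : IsHom (∑ i ∈ s, f i) α l l' :=
  Finset.sum_induction f (IsHom · α l l') (fun _ _ => IsHom.add) (IsHom.zero _ _ _) h

/-! ### The gradings of the maps -/

variable {n : ℕ}

/-- The `t`-grading `M - t A` of a grid state. -/
noncomputable def tGrading (G : GridDiagram n) (t : ℝ≥0) (x : GridState n) : ℝ :=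
  G.maslov x - (t : ℝ) * G.alexander x

/-- The weight of the square `(c, h)`. -/
noncomputable def gridWeight (G : GridDiagram n) (t : ℝ≥0) (c h : Fin n) : TRing t :=
  tMonomial t (if G.X c = h then 1 else 0) (if G.O c = h then 1 else 0)

/-- The exponent of the weight of the square `(c, h)`. -/
noncomputable def gridExponent (G : GridDiagram n) (t : ℝ≥0) (c h : Fin n) : ℝ :=
  (t : ℝ) * (if G.X c = h then 1 else 0) + (2 - t) * (if G.O c = h then 1 else 0)

theorem isMono_gridWeight (ht : t ≤ 2) (G : GridDiagram n) (c h : Fin n) :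
    IsMono (gridExponent G t c h) (gridWeight G t c h) := by
  refine (isMono_tMonomial ht (if G.X c = h then 1 else 0) (if G.O c = h then 1 else 0)).of_eq ?_
  rw [gridExponent]
  push_cast
  rfl

theorem sum_indicator_eq_rectCount (P : Equiv.Perm (Fin n)) (a b p q : Fin n) :
    (∑ c ∈ cyclicIco a b, ∑ h ∈ cyclicIco p q, if P c = h then (1 : ℝ) else 0) =
      rectCount P a b p q := by
  simp only [Finset.sum_ite_eq, rectCount, ite_and]
  rw [Finset.sum_ite_mem, Finset.univ_inter]

/-- The total exponent of an empty rectangle is the difference of gradings, up to one. -/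
theorem sum_gridExponent (G : GridDiagram n) (t : ℝ≥0) {x : GridState n} {a b : Fin n}
    (hab : a ≠ b) (h : IsEmptyRect x a b) :
    (∑ c ∈ cyclicIco a b, ∑ h ∈ cyclicIco (x a) (x b), gridExponent G t c h) =
      tGrading G t (x * Equiv.swap a b) - tGrading G t x + 1 := by
  simp only [gridExponent, Finset.sum_add_distrib, ← Finset.mul_sum, sum_indicator_eq_rectCount]
  have h1 := maslovWith_sub G.O hab h
  have h2 := maslovWith_sub G.X hab h
  simp only [tGrading, GridDiagram.maslov, GridDiagram.alexander]
  linear_combination (1 - (t : ℝ) / 2) * h1 + ((t : ℝ) / 2) * h2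

section Crossing

variable [NeZero n] (G : GridDiagram n) (i j : Fin n)

/-- The grading of a state in the diagram with interchanged columns minus its grading in the
original diagram, as a function of the height of the point on the circle between the columns. -/
noncomputable def gradingShift (t : ℝ≥0) (h : Fin n) : ℝ :=
  (1 - (t : ℝ) / 2) * swapShift (G.O i) (G.O j) h + (t : ℝ) / 2 * swapShift (G.X i) (G.X j) h

theorem gradingShift_add_one (t : ℝ≥0) (h : Fin n) :
    gradingShift G i j t (h + 1) - gradingShift G i j t h =
      gridExponent G t i h - gridExponent G t j h := by
  have h1 := swapShift_add_one (G.O i) (G.O j) h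
  have h2 := swapShift_add_one (G.X i) (G.X j) h
  simp only [gradingShift, gridExponent]
  linear_combination (1 - (t : ℝ) / 2) * h1 + ((t : ℝ) / 2) * h2

variable {G i j} (hpos : G.PositiveColumns i j)
include hpos

omit [NeZero n] in
theorem gridExponent_pos : gridExponent G t i (G.X j) = 0 ∧ gridExponent G t j (G.X j) = t := by
  have h1 : G.X i ≠ G.X j ∧ G.O i ≠ G.X j ∧ G.O j ≠ G.X j := by
    unfold GridDiagram.PositiveColumns GridDiagram.CyclicallyOrdered at hpos
    omega
  simp [gridExponent, h1]

/-- At the two ends of the row in which the circle changes its position, the grading shift is fixed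
by the cyclic order of the four markings. This is where the sign of the crossing enters. -/
theorem gradingShift_pos :
    gradingShift G i j t (G.X j) = 1 ∧ gradingShift G i j t (G.X j + 1) = 1 - t := by
  have h0 : gradingShift G i j t (G.X j) = 1 := by
    have hO : swapShift (G.O i) (G.O j) (G.X j) = 1 := by
      unfold GridDiagram.PositiveColumns GridDiagram.CyclicallyOrdered at hpos
      simp only [swapShift, geInd]
      split_ifs <;> first | (norm_num; done) | (exfalso; omega)
    have hX : swapShift (G.X i) (G.X j) (G.X j) = 1 := by
      rw [swapShift, geInd_self]; ring
    rw [gradingShift, hO, hX]; ring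
  refine ⟨h0, ?_⟩
  have h1 := gradingShift_add_one G i j t (G.X j)
  rw [h0, (gridExponent_pos hpos).1, (gridExponent_pos hpos).2] at h1
  linarith

variable (ht : t ≤ 2) (hj : j = i + 1) (hij : i ≠ j)
include ht

/-- Passing a row upwards is homogeneous. In the row of the `X`-marking of column `j` the exponents
of the transitions require that the potential increases from `0` to `t`. -/
theorem isHom_U (h : Fin n) :
    IsHom ((crossingData TRing.add_self (gridWeight G t) i j (G.X j) hj hij).U h)
      (gridExponent G t j h) (1 - gradingShift G i j t h) (1 - gradingShift G i j t (h + 1)) := by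
  have h1 := gradingShift_add_one G i j t h
  have hi := isMono_gridWeight ht G i h
  have hj' := isMono_gridWeight ht G j h
  by_cases hh : h = G.X j
  · subst hh
    obtain ⟨g1, g2⟩ := gradingShift_pos (t := t) hpos
    obtain ⟨e1, e2⟩ := gridExponent_pos (t := t) hpos
    simp only [crossingData, if_true]
    rw [e1] at hi
    rw [e2] at hj'
    rw [g1, g2, e2]
    refine ⟨hj', ?_, ?_, ?_⟩
    · exact hi.of_eq (by ring)
    · exact hi.of_eq (by ring)
    · exact hi.of_eq (by ring)
  · simp only [crossingData, if_neg hh]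
    exact isHom_ofDiag hj' hi (by linarith)

theorem isHom_D (h : Fin n) :
    IsHom ((crossingData TRing.add_self (gridWeight G t) i j (G.X j) hj hij).D h)
      (gridExponent G t i h) (1 - gradingShift G i j t (h + 1)) (1 - gradingShift G i j t h) := by
  have h1 := gradingShift_add_one G i j t h
  have hi := isMono_gridWeight ht G i h
  have hj' := isMono_gridWeight ht G j h
  by_cases hh : h = G.X j
  · subst hh
    obtain ⟨g1, g2⟩ := gradingShift_pos (t := t) hpos
    obtain ⟨e1, e2⟩ := gridExponent_pos (t := t) hpos
    simp only [crossingData, if_true]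
    rw [e1] at hi
    rw [e2] at hj'
    rw [g1, g2, e1]
    refine ⟨hi, ?_, ?_, ?_⟩
    · exact hj'.of_eq (by ring)
    · exact hi.of_eq (by ring)
    · exact hi.of_eq (by ring)
  · simp only [crossingData, if_neg hh]
    exact isHom_ofDiag hi hj' (by linarith)

/-- The potentials along a vertical side add up to their difference at its ends. -/
theorem isHom_upProd (p q : Fin n) :
    IsHom (upProd (crossingData TRing.add_self (gridWeight G t) i j (G.X j) hj hij).U (rows p q))
      (∑ h ∈ cyclicIco p q, gridExponent G t j h)
      (1 - gradingShift G i j t p) (1 - gradingShift G i j t q) := by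
  have key : ∀ m : ℕ, IsHom (upProd (crossingData TRing.add_self (gridWeight G t) i j (G.X j)
      hj hij).U ((List.range m).map fun m => p + Fin.ofNat n m))
      (((List.range m).map fun m => p + Fin.ofNat n m).map (gridExponent G t j)).sum
      (1 - gradingShift G i j t p) (1 - gradingShift G i j t (p + Fin.ofNat n m)) := by
    intro m
    induction m with
    | zero =>
      rw [show p + Fin.ofNat n 0 = p by ext; simp]
      exact isHom_one _
    | succ m ih =>
      rw [List.range_succ, List.map_append, upProd_append, List.map_append, List.sum_append,
        add_comm (List.sum _)]
      refine IsHom.mul ?_ ih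
      have := isHom_U hpos ht hj hij (p + Fin.ofNat n m)
      rw [add_assoc, show (1 : Fin n) = Fin.ofNat n 1 from rfl, ← ofNat_add] at this
      simpa [upProd] using this
  have := key ((q - p : Fin n) : ℕ)
  rwa [ofNat_val, add_sub_cancel, ← rows, sum_rows] at this

theorem isHom_downProd (p q : Fin n) :
    IsHom (downProd (crossingData TRing.add_self (gridWeight G t) i j (G.X j) hj hij).D (rows p q))
      (∑ h ∈ cyclicIco p q, gridExponent G t i h)
      (1 - gradingShift G i j t q) (1 - gradingShift G i j t p) := by
  have key : ∀ m : ℕ, IsHom (downProd (crossingData TRing.add_self (gridWeight G t) i j (G.X j)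
      hj hij).D ((List.range m).map fun m => p + Fin.ofNat n m))
      (((List.range m).map fun m => p + Fin.ofNat n m).map (gridExponent G t i)).sum
      (1 - gradingShift G i j t (p + Fin.ofNat n m)) (1 - gradingShift G i j t p) := by
    intro m
    induction m with
    | zero =>
      rw [show p + Fin.ofNat n 0 = p by ext; simp]
      exact isHom_one _
    | succ m ih =>
      rw [List.range_succ, List.map_append, downProd_append, List.map_append, List.sum_append]
      refine IsHom.mul ih ?_
      have := isHom_D hpos ht hj hij (p + Fin.ofNat n m)
      rw [add_assoc, show (1 : Fin n) = Fin.ofNat n 1 from rfl, ← ofNat_add] at this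
      simpa [downProd] using this
  have := key ((q - p : Fin n) : ℕ)
  rwa [ofNat_val, add_sub_cancel, ← rows, sum_rows] at this

theorem isHom_weight (x : GridState n) {a b : Fin n} (hab : a ≠ b) :
    IsHom ((crossingData TRing.add_self (gridWeight G t) i j (G.X j) hj hij).weight
        a b (x a) (x b))
      (∑ c ∈ cyclicIco a b, ∑ h ∈ cyclicIco (x a) (x b), gridExponent G t c h)
      (1 - gradingShift G i j t (x j)) (1 - gradingShift G i j t ((x * Equiv.swap a b) j)) := by
  rw [sum_arc_split hij (mem_cyclicIco_of_adjacent hj a b) hab, HolonomyData.weight]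
  refine IsHom.smul ?_ ?_
  · refine IsMono.prod _ fun c _ => ?_
    rw [prod_rows]
    exact IsMono.prod _ fun h _ => isMono_gridWeight ht G c h
  · rw [HolonomyData.sidePart]
    simp only [show (crossingData TRing.add_self (gridWeight G t) i j (G.X j) hj hij).j = j
      from rfl]
    by_cases h1 : a = j
    · subst h1
      rw [if_pos rfl, if_pos rfl, mul_swap_left]
      exact isHom_upProd hpos ht hj hij _ _
    rw [if_neg h1, if_neg h1]
    by_cases h2 : b = j
    · subst h2
      rw [if_pos rfl, if_pos rfl, mul_swap_right]
      exact isHom_downProd hpos ht hj hij _ _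
    rw [if_neg h2, if_neg h2, mul_swap_of_ne x (Ne.symm h1) (Ne.symm h2)]
    split_ifs
    · refine isHom_algebraMap ?_ _
      rw [prod_rows, ← Finset.sum_add_distrib]
      exact IsMono.prod _ fun h _ =>
        (isMono_gridWeight ht G i h).mul (isMono_gridWeight ht G j h)
    · exact isHom_one _

/-- The entries of the matrix of weighted rectangles are homogeneous. -/
theorem isHom_rectMatrix (y x : GridState n) :
    IsHom (rectMatrix (crossingData TRing.add_self (gridWeight G t) i j (G.X j) hj hij).weight y x)
      (tGrading G t y - tGrading G t x + 1)
      (1 - gradingShift G i j t (x j)) (1 - gradingShift G i j t (y j)) := by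
  refine IsHom.sum _ fun a _ => IsHom.sum _ fun b _ => ?_
  split_ifs with h
  · obtain ⟨hab, rfl, hempty⟩ := h
    rw [← sum_gridExponent G t hab hempty]
    exact isHom_weight hpos ht hj hij x hab
  · exact IsHom.zero _ _ _

end Crossing

end Homogeneity

section Homology

variable {n : ℕ} {t : ℝ≥0}

/-! ### The differential as a matrix of rectangles -/

theorem inInterior_iff (r : GridRectangle n) (p : Fin n × Fin n) :
    r.InInterior p ↔ Cyc r.west p.1 r.east ∧ Cyc r.south p.2 r.north := by
  have key : ∀ {a b k : Fin n}, a ≠ b → ((k ∈ cyclicIco a b ∧ k ≠ a) ↔ Cyc a k b) := by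
    intro a b k hab
    rw [mem_cyclicIco_iff_cyc hab]
    constructor
    · rintro ⟨h | h, h'⟩
      · exact absurd h h'
      · exact h
    · exact fun h => ⟨Or.inr h, h.ne.1.symm⟩
  rw [GridRectangle.InInterior, key r.west_ne_east, key r.south_ne_north]

theorem goesFrom_iff (r : GridRectangle n) (x y : GridState n) :
    r.GoesFrom x y ↔
      y = x * Equiv.swap r.west r.east ∧ x r.west = r.south ∧ x r.east = r.north := by
  constructor
  · rintro ⟨h, h1, h2, h3, h4⟩
    refine ⟨Equiv.ext fun k => ?_, h1, h3⟩
    by_cases hw : k = r.west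
    · rw [hw, mul_swap_left, h3, h4]
    by_cases he : k = r.east
    · rw [he, mul_swap_right, h1, h2]
    · rw [mul_swap_of_ne x hw he, h k hw he]
  · rintro ⟨rfl, h1, h2⟩
    exact ⟨fun k hw he => (mul_swap_of_ne x hw he).symm, h1, by rw [mul_swap_right, h1], h2,
      by rw [mul_swap_left, h2]⟩

theorem isEmptyFor_iff {r : GridRectangle n} {x y : GridState n} (h : r.GoesFrom x y) :
    r.IsEmptyFor x y ↔ IsEmptyRect x r.west r.east := by
  simp only [GridRectangle.IsEmptyFor, IsEmptyRect, inInterior_iff, h.2.1, h.2.2.2.1]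
  refine forall_congr' fun k => and_iff_left_of_imp fun hk hk' => hk ?_
  rwa [h.1 k hk'.1.ne.1.symm hk'.1.ne.2.1]

theorem mem_emptyRectangles {r : GridRectangle n} {x y : GridState n} :
    r ∈ emptyRectangles x y ↔ r.GoesFrom x y ∧ r.IsEmptyFor x y := by
  simp [emptyRectangles]

/-- The sum over the empty rectangles from `x` to `y` as an entry of a matrix of rectangles. -/
theorem sum_emptyRectangles {A : Type*} [Ring A] (w : Fin n → Fin n → Fin n → Fin n → A)
    (x y : GridState n) :
    ∑ r ∈ emptyRectangles x y, w r.west r.east r.south r.north = rectMatrix w y x := by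
  classical
  rw [rectMatrix, ← Finset.sum_product', ← Finset.sum_filter]
  refine Finset.sum_bij (fun r _ => (r.west, r.east)) ?_ ?_ ?_ ?_
  · intro r hr
    obtain ⟨h1, h2⟩ := mem_emptyRectangles.1 hr
    simp only [Finset.mem_filter, Finset.mem_product, Finset.mem_univ, true_and]
    exact ⟨r.west_ne_east, ((goesFrom_iff r x y).1 h1).1, (isEmptyFor_iff h1).1 h2⟩
  · intro r hr r' hr' h
    obtain ⟨-, h1, h2⟩ := (goesFrom_iff r x y).1 (mem_emptyRectangles.1 hr).1
    obtain ⟨-, h1', h2'⟩ := (goesFrom_iff r' x y).1 (mem_emptyRectangles.1 hr').1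
    rw [Prod.mk.injEq] at h
    apply GridRectangle.corners_injective
    simp only
    rw [← h1, ← h2, ← h1', ← h2', h.1, h.2]
  · rintro ⟨a, b⟩ h
    simp only [Finset.mem_filter, Finset.mem_product, Finset.mem_univ, true_and] at h
    obtain ⟨hab, hy, hempty⟩ := h
    have hg : GridRectangle.GoesFrom ⟨a, b, x a, x b, hab, x.injective.ne hab⟩ x y :=
      (goesFrom_iff _ x y).2 ⟨hy, rfl, rfl⟩
    exact ⟨_, mem_emptyRectangles.2 ⟨hg, (isEmptyFor_iff hg).2 hempty⟩, rfl⟩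
  · intro r hr
    obtain ⟨-, h1, h2⟩ := (goesFrom_iff r x y).1 (mem_emptyRectangles.1 hr).1
    rw [h1, h2]

theorem markingCount_eq (r : GridRectangle n) (P : Equiv.Perm (Fin n)) :
    r.markingCount P =
      ∑ c ∈ cyclicIco r.west r.east, ∑ h ∈ cyclicIco r.south r.north, if P c = h then 1 else 0 := by
  simp only [GridRectangle.markingCount, GridRectangle.squares, Finset.mem_product,
    Finset.card_filter, Finset.sum_ite_eq, ite_and]
  rw [Finset.sum_ite_mem, Finset.univ_inter]

theorem squareWeight_gridWeight (G : GridDiagram n) (r : GridRectangle n) :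
    squareWeight (gridWeight G t) r.west r.east r.south r.north =
      tMonomial t (r.markingCount G.X) (r.markingCount G.O) := by
  simp only [squareWeight, gridWeight, prod_tMonomial, markingCount_eq]

theorem tDiff_single (G : GridDiagram n) (x y : GridState n) :
    G.tDiff t (Pi.single x 1) y =
      ∑ r ∈ emptyRectangles x y, tMonomial t (r.markingCount G.X) (r.markingCount G.O) := by
  rw [GridDiagram.tDiff, Fintype.linearCombination_apply_single, one_smul, Finset.sum_apply,
    Finset.sum_pi_single]
  simp

theorem tDiff_eq (G : GridDiagram n) :
    G.tDiff t = (rectMatrix (squareWeight (gridWeight G t))).mulVecLin := by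
  refine LinearMap.pi_ext' fun x => LinearMap.ext_ring ?_
  ext y
  simp only [LinearMap.comp_apply, LinearMap.single_apply, Matrix.mulVecLin_apply,
    Matrix.mulVec_single_one, Matrix.col_apply]
  rw [tDiff_single, ← sum_emptyRectangles]
  exact Finset.sum_congr rfl fun r _ => (squareWeight_gridWeight G r).symm

/-! ### Homogeneous maps -/

/-- A module map between grid complexes is homogeneous of degree `s`. -/
def MapsHomogeneous (G G' : GridDiagram n) (f : G.tGC t →ₗ[TRing t] G'.tGC t) (s : ℝ) : Prop :=
  ∀ d, ∀ z ∈ G.tGCHomogeneous t d, f z ∈ G'.tGCHomogeneous t (d + s)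

theorem single_mem_tGCHomogeneous (G : GridDiagram n) {x : GridState n} {α d : ℝ} {z : TRing t}
    (hz : IsMono α z) (hd : tGrading G t x - α = d) :
    (Pi.single x z : G.tGC t) ∈ G.tGCHomogeneous t d := by
  rcases hz.eq_zero_or with rfl | ⟨e, he, rfl, rfl⟩
  · rw [Pi.single_zero]
    exact zero_mem _
  · exact Submodule.subset_span ⟨x, e, he, hd, rfl⟩

theorem mapsHomogeneous_mulVecLin (G G' : GridDiagram n) {s : ℝ}
    {C : Matrix (GridState n) (GridState n) (TRing t)}
    (hC : ∀ y x, IsMono (tGrading G' t y - tGrading G t x - s) (C y x)) :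
    MapsHomogeneous G G' C.mulVecLin s := by
  intro d
  suffices h : G.tGCHomogeneous t d ≤
      (G'.tGCHomogeneous t (d + s)).comap (C.mulVecLin.restrictScalars (ZMod 2)) from h
  refine Submodule.span_le.2 ?_
  rintro _ ⟨x, α, hα, hd, rfl⟩
  have key : ∀ u : TRing t, IsMono α u →
      C.mulVecLin (Pi.single x u) ∈ G'.tGCHomogeneous t (d + s) := by
    intro u hu
    have hsum : C.mulVecLin (Pi.single x u) = ∑ y, (Pi.single y (C y x * u) : G'.tGC t) := by
      ext y
      rw [Finset.sum_apply, Finset.sum_pi_single]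
      simp [Matrix.mulVec_single]
    rw [hsum]
    refine Submodule.sum_mem _ fun y _ => single_mem_tGCHomogeneous G' ((hC y x).mul hu) ?_
    rw [← hd, tGrading, tGrading]
    ring
  exact key _ (isMono_Upow α hα)

/-! ### From the complexes to homology -/

/-- Chain maps in both directions between the complexes of two diagrams, of degrees `0` and
`-2 + t`, whose composites are homotopic to the multiplication by `U ^ (2 - t)`. -/
structure CrossingMaps (Gp Gm : GridDiagram n) (t : ℝ≥0) where
  f : Gp.tGC t →ₗ[TRing t] Gm.tGC t
  g : Gm.tGC t →ₗ[TRing t] Gp.tGC t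
  hp : Gp.tGC t →ₗ[TRing t] Gp.tGC t
  hm : Gm.tGC t →ₗ[TRing t] Gm.tGC t
  f_comm : ∀ z, f (Gp.tDiff t z) = Gm.tDiff t (f z)
  g_comm : ∀ z, g (Gm.tDiff t z) = Gp.tDiff t (g z)
  f_homogeneous : MapsHomogeneous Gp Gm f 0
  g_homogeneous : MapsHomogeneous Gm Gp g (-2 + (t : ℝ))
  homotopy_p : ∀ z, hp (Gp.tDiff t z) + g (f z) + Gp.tDiff t (hp z) = UtwoSub t • z
  homotopy_m : ∀ z, hm (Gm.tDiff t z) + f (g z) + Gm.tDiff t (hm z) = UtwoSub t • z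

/-- The map induced on homology by a chain map. -/
noncomputable def inducedMap {G G' : GridDiagram n} (f : G.tGC t →ₗ[TRing t] G'.tGC t)
    (hf : ∀ z, f (G.tDiff t z) = G'.tDiff t (f z)) : G.tGH t →ₗ[TRing t] G'.tGH t :=
  Submodule.mapQ _ _ (f.restrict (p := LinearMap.ker (G.tDiff t)) (q := LinearMap.ker (G'.tDiff t))
    fun z hz => by rw [LinearMap.mem_ker] at hz ⊢; rw [← hf, hz, map_zero]) (by
      rintro z ⟨y, hy⟩
      exact ⟨f y, by rw [← hf, hy]; rfl⟩)

theorem inducedMap_isHomogeneousOfDegree {G G' : GridDiagram n}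
    (f : G.tGC t →ₗ[TRing t] G'.tGC t) (hf : ∀ z, f (G.tDiff t z) = G'.tDiff t (f z)) {s : ℝ}
    (hs : MapsHomogeneous G G' f s) :
    GridDiagram.IsHomogeneousOfDegree (inducedMap f hf) s := by
  rintro d _ ⟨z, hz, rfl⟩
  exact ⟨_, hs d _ hz, rfl⟩

/-- On homology, homotopic chain maps agree. -/
theorem inducedMap_inducedMap {G G' : GridDiagram n} {f : G.tGC t →ₗ[TRing t] G'.tGC t}
    {g : G'.tGC t →ₗ[TRing t] G.tGC t} (hf : ∀ z, f (G.tDiff t z) = G'.tDiff t (f z))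
    (hg : ∀ z, g (G'.tDiff t z) = G.tDiff t (g z)) {h : G.tGC t →ₗ[TRing t] G.tGC t} {u : TRing t}
    (hh : ∀ z, h (G.tDiff t z) + g (f z) + G.tDiff t (h z) = u • z) (ξ : G.tGH t) :
    inducedMap g hg (inducedMap f hf ξ) = u • ξ := by
  obtain ⟨z, rfl⟩ := Submodule.Quotient.mk_surjective _ ξ
  refine (Submodule.Quotient.eq _).2 ⟨-h z.1, ?_⟩
  have h1 := hh z.1
  rw [LinearMap.mem_ker.1 z.2, map_zero, zero_add] at h1
  show G.tDiff t (-h z.1) = g (f z.1) - u • z.1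
  rw [← h1, map_neg]
  abel

/-! ### Cross-commutations of columns -/

theorem tMonomial_zero_one : tMonomial t 0 1 = UtwoSub t := by
  apply Subtype.ext
  show Upow _ = Upow _
  simp

theorem prod_gridWeight_column (G : GridDiagram n) (c : Fin n) :
    ∏ h, gridWeight G t c h = tMonomial t 1 1 := by
  simp [gridWeight, prod_tMonomial]

theorem prod_gridWeight_row (G : GridDiagram n) (h : Fin n) :
    ∏ c, gridWeight G t c h = tMonomial t 1 1 := by
  simp only [gridWeight, prod_tMonomial, ← Equiv.eq_symm_apply, Finset.sum_ite_eq',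
    Finset.mem_univ, if_true]

theorem prod_gridWeight_erase (G : GridDiagram n) (c : Fin n) :
    ∏ h ∈ Finset.univ.erase (G.X c), gridWeight G t c h = UtwoSub t := by
  simp [gridWeight, prod_tMonomial, (G.X_ne_O c).symm, tMonomial_zero_one]

/-- The comparison of the gradings of a state in the two diagrams. -/
theorem tGrading_swap [NeZero n] {G G' : GridDiagram n} {i j : Fin n} (hj : j = i + 1)
    (hij : i ≠ j) (hX : G'.X = G.X * Equiv.swap i j) (hO : G'.O = G.O * Equiv.swap i j)
    (x : GridState n) :
    tGrading G' t x = tGrading G t x + gradingShift G i j t (x j) := by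
  simp only [tGrading, GridDiagram.maslov, GridDiagram.alexander, gradingShift, hX, hO,
    maslovWith_mul_swap _ x hj hij]
  ring

theorem gridWeight_swap {G G' : GridDiagram n} {i j : Fin n} (hX : G'.X = G.X * Equiv.swap i j)
    (hO : G'.O = G.O * Equiv.swap i j) :
    gridWeight G' t = fun c => gridWeight G t (Equiv.swap i j c) := by
  ext c h
  rw [gridWeight, gridWeight, hX, hO]
  rfl

/-- The maps are the entries `(1, 0)` and `(2, 1)` of the matrix of weighted rectangles, the
homotopies are its entries `(2, 0)` and `(3, 1)`. -/
theorem nonempty_crossingMaps_of_columns {Gp Gm : GridDiagram n}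
    (h : GridDiagram.ColumnCrossCommutation Gp Gm) (ht : t ≤ 2) :
    Nonempty (CrossingMaps Gp Gm t) := by
  obtain ⟨i, j, hj, -, hpos, hX, hO⟩ := h
  have : NeZero n := ⟨(Nat.zero_le _).trans_lt i.2 |>.ne'⟩
  have hj : j = i + 1 := by
    ext
    rw [hj, Fin.val_add, Fin.val_one', Nat.add_mod_mod]
  have hne : Gp.X i ≠ Gp.X j ∧ Gp.O i ≠ Gp.X j := by
    unfold GridDiagram.PositiveColumns GridDiagram.CyclicallyOrdered at hpos
    omega
  have hij : i ≠ j := fun h => hne.1 (by rw [h])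
  have hρ : gridWeight Gp t i (Gp.X j) = 1 := by
    rw [gridWeight, if_neg hne.1, if_neg hne.2, tMonomial_zero]
  set D := crossingMatrix TRing.add_self (gridWeight Gp t) i j (Gp.X j) hj hij with hD
  have h0 : Gp.tDiff t = (D 0 0).mulVecLin := by rw [hD, crossingMatrix_zero, tDiff_eq]
  have h1 : Gm.tDiff t = (D 1 1).mulVecLin := by
    rw [hD, crossingMatrix_one, tDiff_eq, gridWeight_swap hX hO]
  obtain ⟨r1, r2, r3, r4⟩ := crossingMatrix_relations TRing.add_self (gridWeight Gp t) i j (Gp.X j)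
    hj hij _ (prod_gridWeight_column Gp) (prod_gridWeight_row Gp) hρ
  rw [prod_gridWeight_erase, ← hD] at r3 r4
  rw [← hD] at r1 r2
  -- in characteristic two, the vanishing of a sum of two terms means that they agree
  have hchar : ∀ {A B : Matrix (GridState n) (GridState n) (TRing t)}, A + B = 0 → A = B := by
    intro A B h
    ext y x
    have h' : A y x + B y x = 0 := congrFun (congrFun h y) x
    rw [eq_neg_of_add_eq_zero_left h', neg_eq_of_add_eq_zero_left (TRing.add_self _)]
  have hscalar : ∀ z : GridState n → TRing t,
      (Matrix.scalar (GridState n) (UtwoSub t)).mulVec z = UtwoSub t • z := by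
    intro z
    ext y
    simp [Matrix.scalar_apply, Matrix.mulVec_diagonal]
  have hgr := tGrading_swap (t := t) hj hij hX hO
  have hom := isHom_rectMatrix hpos ht hj hij
  refine ⟨⟨(D 1 0).mulVecLin, (D 2 1).mulVecLin, (D 2 0).mulVecLin, (D 3 1).mulVecLin,
    fun z => ?_, fun z => ?_, ?_, ?_, fun z => ?_, fun z => ?_⟩⟩
  · simp only [h0, h1, Matrix.mulVecLin_apply, Matrix.mulVec_mulVec, hchar r1]
  · simp only [h0, h1, Matrix.mulVecLin_apply, Matrix.mulVec_mulVec, hchar r2]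
  · refine mapsHomogeneous_mulVecLin _ _ fun y x => (hom y x).e10.of_eq ?_
    rw [hgr]
    ring
  · refine mapsHomogeneous_mulVecLin _ _ fun y x => (hom y x).e21.of_eq ?_
    rw [hgr]
    ring
  · simp only [h0, Matrix.mulVecLin_apply, Matrix.mulVec_mulVec, ← Matrix.add_mulVec]
    rw [r3, hscalar]
  · simp only [h1, Matrix.mulVecLin_apply, Matrix.mulVec_mulVec, ← Matrix.add_mulVec]
    rw [r4, hscalar]

/-! ### The complex of a reflected diagram -/

/-- The reflection of a rectangle in the diagonal. -/
def transposeRect (r : GridRectangle n) : GridRectangle n :=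
  ⟨r.south, r.north, r.west, r.east, r.south_ne_north, r.west_ne_east⟩

theorem transposeRect_mem {r : GridRectangle n} {x y : GridState n}
    (h : r ∈ emptyRectangles x y) : transposeRect r ∈ emptyRectangles x⁻¹ y⁻¹ := by
  obtain ⟨h1, h2⟩ := mem_emptyRectangles.1 h
  obtain ⟨hy, hs, hn⟩ := (goesFrom_iff r x y).1 h1
  have h3 : (transposeRect r).GoesFrom x⁻¹ y⁻¹ := by
    refine (goesFrom_iff _ _ _).2 ⟨?_, ?_, ?_⟩
    · show y⁻¹ = x⁻¹ * Equiv.swap r.south r.north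
      rw [hy, ← hs, ← hn, mul_inv_rev, Equiv.swap_inv, Equiv.mul_swap_eq_swap_mul]
      simp
    · show x⁻¹ r.south = r.west
      rw [← hs]; simp
    · show x⁻¹ r.north = r.east
      rw [← hn]; simp
  refine mem_emptyRectangles.2 ⟨h3, (isEmptyFor_iff h3).2 fun k hk => ?_⟩
  have hk' : Cyc r.south k r.north ∧ Cyc (x⁻¹ r.south) (x⁻¹ k) (x⁻¹ r.north) := hk
  rw [← hs, ← hn] at hk'
  refine (isEmptyFor_iff h1).1 h2 (x⁻¹ k) ⟨?_, ?_⟩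
  · simpa using hk'.2
  · simpa using hk'.1

theorem markingCount_transposeRect (r : GridRectangle n) (P : Equiv.Perm (Fin n)) :
    (transposeRect r).markingCount P⁻¹ = r.markingCount P := by
  refine Finset.card_equiv P⁻¹ fun c => ?_
  simp [GridRectangle.squares, transposeRect, and_comm]

theorem tGrading_transpose (G : GridDiagram n) (x : GridState n) :
    tGrading G.transpose t x⁻¹ = tGrading G t x := by
  simp only [tGrading, GridDiagram.maslov, GridDiagram.alexander, GridDiagram.transpose,
    maslovWith_inv]

/-- The reflection in the diagonal on grid chains. -/
noncomputable def reflect (n : ℕ) (t : ℝ≥0) :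
    (GridState n → TRing t) →ₗ[TRing t] (GridState n → TRing t) :=
  LinearMap.funLeft (TRing t) (TRing t) fun x => x⁻¹

theorem reflect_single (x : GridState n) (z : TRing t) :
    reflect n t (Pi.single x z) = Pi.single x⁻¹ z := by
  ext y
  simp only [reflect, LinearMap.funLeft_apply, Pi.single_apply, inv_eq_iff_eq_inv]

theorem reflect_reflect (z : GridState n → TRing t) : reflect n t (reflect n t z) = z := by
  ext y
  simp [reflect, LinearMap.funLeft_apply]

theorem tDiff_transpose_reflect (G : GridDiagram n) (z : G.tGC t) :
    G.transpose.tDiff t (reflect n t z) = reflect n t (G.tDiff t z) := by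
  suffices h : G.transpose.tDiff t ∘ₗ reflect n t = reflect n t ∘ₗ G.tDiff t from
    LinearMap.congr_fun h z
  refine LinearMap.pi_ext' fun x => LinearMap.ext_ring (funext fun y => ?_)
  show G.transpose.tDiff t (reflect n t (Pi.single x 1)) y = G.tDiff t (Pi.single x 1) y⁻¹
  rw [reflect_single, tDiff_single, tDiff_single]
  refine (Finset.sum_bij' (fun r _ => transposeRect r) (fun r _ => transposeRect r)
    (fun r hr => ?_) (fun r hr => ?_) (fun _ _ => rfl) (fun _ _ => rfl) (fun r _ => ?_)).symm
  · simpa using transposeRect_mem hr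
  · simpa using transposeRect_mem hr
  · rw [← markingCount_transposeRect r G.X, ← markingCount_transposeRect r G.O]
    rfl

theorem mapsHomogeneous_reflect (G : GridDiagram n) :
    MapsHomogeneous (t := t) G G.transpose (reflect n t) 0 := by
  intro d
  suffices h : G.tGCHomogeneous t d ≤ (G.transpose.tGCHomogeneous t (d + 0)).comap
      ((reflect n t).restrictScalars (ZMod 2)) from h
  refine Submodule.span_le.2 ?_
  rintro _ ⟨x, α, hα, hd, rfl⟩
  have key : ∀ u : TRing t, IsMono α u →
      reflect n t (Pi.single x u) ∈ G.transpose.tGCHomogeneous t (d + 0) := by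
    intro u hu
    rw [reflect_single]
    refine single_mem_tGCHomogeneous G.transpose hu ?_
    rw [tGrading_transpose, add_zero, ← hd, tGrading]
  exact key _ (isMono_Upow α hα)

theorem MapsHomogeneous.comp {G G' G'' : GridDiagram n} {f : G.tGC t →ₗ[TRing t] G'.tGC t}
    {g : G'.tGC t →ₗ[TRing t] G''.tGC t} {s s' : ℝ} (hg : MapsHomogeneous G' G'' g s')
    (hf : MapsHomogeneous G G' f s) : MapsHomogeneous G G'' (g ∘ₗ f) (s + s') := by
  intro d z hz
  rw [← add_assoc]
  exact hg _ _ (hf d z hz)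

/-- Conjugation of a map by the reflection in the diagonal. -/
noncomputable def conjReflect (f : (GridState n → TRing t) →ₗ[TRing t] (GridState n → TRing t)) :
    (GridState n → TRing t) →ₗ[TRing t] (GridState n → TRing t) :=
  reflect n t ∘ₗ f ∘ₗ reflect n t

theorem conjReflect_homogeneous {G G' : GridDiagram n}
    {f : (GridState n → TRing t) →ₗ[TRing t] (GridState n → TRing t)} {s : ℝ}
    (hf : MapsHomogeneous G.transpose G'.transpose f s) :
    MapsHomogeneous G G' (conjReflect f) s := by
  have := (mapsHomogeneous_reflect (t := t) G'.transpose).comp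
    (hf.comp (mapsHomogeneous_reflect G))
  rw [zero_add, add_zero] at this
  exact this

theorem conjReflect_comm {G G' : GridDiagram n}
    {f : (GridState n → TRing t) →ₗ[TRing t] (GridState n → TRing t)}
    (hf : ∀ z, f (G.transpose.tDiff t z) = G'.transpose.tDiff t (f z)) (z : GridState n → TRing t) :
    conjReflect f (G.tDiff t z) = G'.tDiff t (conjReflect f z) := by
  show reflect n t (f (reflect n t (G.tDiff t z))) = G'.tDiff t (reflect n t (f (reflect n t z)))
  rw [← tDiff_transpose_reflect, hf]
  exact (tDiff_transpose_reflect G'.transpose _).symm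

theorem conjReflect_homotopy {G : GridDiagram n}
    {f g h : (GridState n → TRing t) →ₗ[TRing t] (GridState n → TRing t)} {u : TRing t}
    (hh : ∀ z, h (G.transpose.tDiff t z) + g (f z) + G.transpose.tDiff t (h z) = u • z)
    (z : GridState n → TRing t) :
    conjReflect h (G.tDiff t z) + conjReflect g (conjReflect f z) + G.tDiff t (conjReflect h z) =
      u • z := by
  show reflect n t (h (reflect n t (G.tDiff t z))) +
    reflect n t (g (reflect n t (reflect n t (f (reflect n t z))))) +
    G.tDiff t (reflect n t (h (reflect n t z))) = u • z
  have h1 : G.tDiff t (reflect n t (h (reflect n t z))) =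
      reflect n t (G.transpose.tDiff t (h (reflect n t z))) :=
    tDiff_transpose_reflect G.transpose _
  rw [← tDiff_transpose_reflect, reflect_reflect, h1, ← map_add, ← map_add, hh, map_smul,
    reflect_reflect]

/-- The maps for the reflected diagrams, reflected back. -/
noncomputable def CrossingMaps.ofTranspose {Gp Gm : GridDiagram n}
    (C : CrossingMaps Gp.transpose Gm.transpose t) : CrossingMaps Gp Gm t where
  f := conjReflect C.f
  g := conjReflect C.g
  hp := conjReflect C.hp
  hm := conjReflect C.hm
  f_comm := conjReflect_comm C.f_comm
  g_comm := conjReflect_comm C.g_comm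
  f_homogeneous := conjReflect_homogeneous C.f_homogeneous
  g_homogeneous := conjReflect_homogeneous C.g_homogeneous
  homotopy_p := conjReflect_homotopy C.homotopy_p
  homotopy_m := conjReflect_homotopy C.homotopy_m

end Homology

end GridCrossing

theorem mainTheorem5 {n : ℕ} (Gp Gm : GridDiagram n) (hp : Gp.IsKnot) (hm : Gm.IsKnot)
    (hcross : GridDiagram.CrossCommutation Gp Gm) (t : ℝ≥0) (ht : t ≤ 2) :
    ∃ (Cm : Gp.tGH t →ₗ[TRing t] Gm.tGH t) (Cp : Gm.tGH t →ₗ[TRing t] Gp.tGH t),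
      GridDiagram.IsHomogeneousOfDegree Cm 0 ∧
      GridDiagram.IsHomogeneousOfDegree Cp (-2 + (t : ℝ)) ∧
      (∀ ξ : Gm.tGH t, Cm (Cp ξ) = UtwoSub t • ξ) ∧
      (∀ ξ : Gp.tGH t, Cp (Cm ξ) = UtwoSub t • ξ) := by
  have hC : Nonempty (GridCrossing.CrossingMaps Gp Gm t) := by
    rcases hcross with h | h
    · exact GridCrossing.nonempty_crossingMaps_of_columns h ht
    · exact (GridCrossing.nonempty_crossingMaps_of_columns h ht).map
        GridCrossing.CrossingMaps.ofTranspose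
  obtain ⟨C⟩ := hC
  exact ⟨GridCrossing.inducedMap C.f C.f_comm, GridCrossing.inducedMap C.g C.g_comm,
    GridCrossing.inducedMap_isHomogeneousOfDegree _ _ C.f_homogeneous,
    GridCrossing.inducedMap_isHomogeneousOfDegree _ _ C.g_homogeneous,
    GridCrossing.inducedMap_inducedMap C.g_comm C.f_comm C.homotopy_m,
    GridCrossing.inducedMap_inducedMap C.f_comm C.g_comm C.homotopy_p⟩
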